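/- Let $m\ge 2$, let $f_{i,i+1}>0$ and $f_{i+1,i}>0$ ($i=1,\dots,m-1$) and $\beta>0$ be real constants, $f_{1,0}:=f_{m,m+1}:=0$, and let $\mathsf F=(f_{ij})$ be the tridiagonal $m\times m$ matrix with these off-diagonal entries, with $f_{ii}:=-f_{i,i-1}-f_{i,i+1}$ and $f_{ij}:=0$ for $|i-j|>1$. The multi-layer quasi-geostrophic model is the system \[ q^i_t+\psi^i_xq^i_y-\psi^i_yq^i_x=0,\qquad q^i:=\psi^i_{xx}+\psi^i_{yy}+(\mathsf F\psi)^i+\beta y,\qquad i=1,\dots,m, \] for the unknown functions $\psi=(\psi^1,\dots,\psi^m)^{\mathsf T}$ of $(t,x,y)$; let $\mathfrak g$ be its maximal Lie invariance algebra. Let $a\in\mathbb R$ and $c=(c_1,\dots,c_m)^{\mathsf T}\in\operatorname{im}\mathsf F$, and let $\mathfrak s:=\langle\partial_t+a\partial_y+\sum_kc_k\partial_{\psi^k}\rangle\subset\mathfrak g$. The ansatz $\psi^i=v^i(z_1,z_2)+c_it+ax$ with $z_1=x$, $z_2=y-at$ reduces the model to the system \[ v^i_1w^i_2-v^i_2w^i_1+(\mathsf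 Fc)^i+a\beta=0,\qquad w^i:=v^i_{11}+v^i_{22}+(\mathsf Fv)^i+\beta z_2,\qquad i=1,\dots,m, \] where the subscripts $1$ and $2$ denote derivatives with respect to $z_1$ and $z_2$. Then, for all such values of the parameters, the maximal Lie invariance algebra of this reduced system is the linear span \[\langle\partial_{z_1},\partial_{z_2},\partial_{v^1},\dots,\partial_{v^m}\rangle,\] and it is entirely induced by $\mathfrak g$: it coincides with the algebra of the vector fields that the elements of the normalizer $\mathrm N_{\mathfrak g}(\mathfrak s)$ induce in the space of the invariant variables $(z_1,z_2,v^1,\dots,v^m)$. Here the maximal Lie invariance algebra of a system consists of all smooth vector fields in the space of its independent and dependent variables (over a connected open set $U$ of this space for the reduced system, and over the preimage of $U$ under $(t,x,y,\psi)\mapsto(z,v)$ for the model) whose prolongations annihilate the left-hand sides of the equations at all jets that satisfy the system. -/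

import Mathlib

open scoped ContDiff

noncomputable section

namespace QG

/-! ### Jets, total derivatives and prolongations

There are `n` independent variables `x` and `m` dependent variables `u`. -/

/-- The space of independent and dependent variables `(x, u)`. -/
abbrev Base (n m : ℕ) : Type := (Fin n → ℝ) × (Fin m → ℝ)

/-- A vector field `∑ ξ^μ(x,u) ∂_{x_μ} + ∑ η^j(x,u) ∂_{u^j}`, as the map `(x, u) ↦ (ξ, η)`. -/
abbrev VectorFieldOn (n m : ℕ) : Type := Base n m → Base n m

/-- The (infinite-order) jet space: the coordinates are the `x_μ` and the `u^j_α`, with `α` a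
multi-index.  The same type also serves for its tangent vectors. -/
abbrev Jet (n m : ℕ) : Type := (Fin n → ℝ) × (Fin m → (Fin n → ℕ) → ℝ)

/-- The multi-index `e_μ`. -/
abbrev unitIndex {n : ℕ} (μ : Fin n) : Fin n → ℕ := Pi.single μ 1

/-- The projection of a jet to its `(x, u)` part. -/
def base {n m : ℕ} (p : Jet n m) : Base n m := (p.1, fun j => p.2 j 0)

/-- The total derivative `D_μ = ∂_{x_μ} + ∑_{j,α} u^j_{α + e_μ} ∂_{u^j_α}`: the derivative along the
vector field on the jet space whose `x`-part is `e_μ` and whose `u^j_α`-part is `u^j_{α + e_μ}`. -/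
def totalDeriv {n m : ℕ} (μ : Fin n) (A : Jet n m → ℝ) : Jet n m → ℝ := fun p =>
  lineDeriv ℝ A p (Pi.single μ 1, fun j α => p.2 j (α + unitIndex μ))

/-- The iterated total derivative `D^α = D_0^{α_0} ⋯ D_{n-1}^{α_{n-1}}`. -/
def totalDerivs {n m : ℕ} (α : Fin n → ℕ) (A : Jet n m → ℝ) : Jet n m → ℝ :=
  (List.finRange n).foldr (fun μ B => (totalDeriv μ)^[α μ] B) A

/-- The characteristic `Q[u]^j = η^j - ∑_μ ξ^μ u^j_μ` of a vector field. -/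
def characteristic {n m : ℕ} (Q : VectorFieldOn n m) (j : Fin m) : Jet n m → ℝ := fun p =>
  (Q (base p)).2 j - ∑ μ, (Q (base p)).1 μ * p.2 j (unitIndex μ)

/-- The prolongation of a vector field to the jet space, with components `ξ^μ` and
`η^{j,α} = D^α (η^j - ∑_μ ξ^μ u^j_μ) + ∑_μ ξ^μ u^j_{α + e_μ}`. -/
def prolongation {n m : ℕ} (Q : VectorFieldOn n m) (p : Jet n m) : Jet n m :=
  ((Q (base p)).1, fun j α =>
    totalDerivs α (characteristic Q j) p + ∑ μ, (Q (base p)).1 μ * p.2 j (α + unitIndex μ))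

/-- The maximal Lie invariance algebra, on the open set `U` of the space of the variables `(x, u)`,
of the system of differential equations `E^i = 0`: all vector fields that are smooth on `U` and
satisfy the infinitesimal invariance criterion, i.e. the prolonged field annihilates each `E^i` at
each jet over `U` that satisfies the system.  Only the values on `U` of the vector field matter. -/
def maxLieInvarianceAlgebra {n m : ℕ} {ι : Type} (E : ι → Jet n m → ℝ) (U : Set (Base n m)) :
    Set (VectorFieldOn n m) :=
  {Q | ContDiffOn ℝ ∞ Q U ∧
    ∀ p : Jet n m, base p ∈ U → (∀ i, E i p = 0) →
      ∀ i, lineDeriv ℝ (E i) p (prolongation Q p) = 0}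

/-- The normalizer, in a set `g` of vector fields on `U`, of a space `s` of vector fields. -/
def normalizer {n m : ℕ} (g : Set (VectorFieldOn n m)) (s : Submodule ℝ (VectorFieldOn n m))
    (U : Set (Base n m)) : Set (VectorFieldOn n m) :=
  {Q | Q ∈ g ∧ ∀ S ∈ s, ∃ S' ∈ s, Set.EqOn (VectorField.lieBracket ℝ Q S) S' U}

/-- The vector field `∂_{x_μ}`. -/
def partialX {n m : ℕ} (μ : Fin n) : VectorFieldOn n m := fun _ => (Pi.single μ 1, 0)

/-- The vector field `∂_{u^j}`. -/
def partialU {n m : ℕ} (j : Fin m) : VectorFieldOn n m := fun _ => (0, Pi.single j 1)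

/-- The Poisson bracket (Jacobian) `D_μ A D_ν B - D_ν A D_μ B`. -/
def poisson {n m : ℕ} (μ ν : Fin n) (A B : Jet n m → ℝ) : Jet n m → ℝ := fun p =>
  totalDeriv μ A p * totalDeriv ν B p - totalDeriv ν A p * totalDeriv μ B p

/-! ### The multi-layer quasi-geostrophic model and its reduction -/

/-- Neighbouring layers. -/
abbrev Adjacent {m : ℕ} (i j : Fin m) : Prop := i.val + 1 = j.val ∨ j.val + 1 = i.val

/-- The vertical coupling matrix: tridiagonal, with zero row sums and with the entries `f i j` for
neighbouring layers `i`, `j` (the other values of `f` are not used). -/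
def couplingMatrix {m : ℕ} (f : Fin m → Fin m → ℝ) : Matrix (Fin m) (Fin m) ℝ :=
  Matrix.of fun i j =>
    if Adjacent i j then f i j
    else if i = j then -∑ k, (if Adjacent i k then f i k else 0)
    else 0

/-- The potential vorticity `q^i = ψ^i_{xx} + ψ^i_{yy} + (F ψ)^i + β y`; the independent variables
are `(t, x, y)`, numbered `0, 1, 2`. -/
def vorticity {m : ℕ} (F : Matrix (Fin m) (Fin m) ℝ) (β : ℝ) (i : Fin m) : Jet 3 m → ℝ := fun p =>
  p.2 i ![0, 2, 0] + p.2 i ![0, 0, 2] + (F.mulVec fun j => p.2 j 0) i + β * p.1 2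

/-- The left-hand sides of the multi-layer model `q^i_t + {ψ^i, q^i} = 0`. -/
def model {m : ℕ} (F : Matrix (Fin m) (Fin m) ℝ) (β : ℝ) (i : Fin m) : Jet 3 m → ℝ := fun p =>
  totalDeriv 0 (vorticity F β i) p + poisson 1 2 (fun p => p.2 i 0) (vorticity F β i) p

/-- The basis element `∂_t + a ∂_y + ∑_k c_k ∂_{ψ^k}` of the reduction subalgebra. -/
def generator {m : ℕ} (a : ℝ) (c : Fin m → ℝ) : VectorFieldOn 3 m :=
  partialX 0 + a • partialX 2 + ∑ k, c k • partialU k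

/-- The invariants `z_1 = x`, `z_2 = y - a t`, `v^i = ψ^i - c_i t - a x` of the subalgebra spanned
by `generator a c`, as a map `(t, x, y, ψ) ↦ (z, v)`; the ansatz is `ψ^i = v^i(z) + c_i t + a x`. -/
def invariants {m : ℕ} (a : ℝ) (c : Fin m → ℝ) : Base 3 m → Base 2 m := fun P =>
  (![P.1 1, P.1 2 - a * P.1 0], fun i => P.2 i - c i * P.1 0 - a * P.1 1)

/-- `w^i = v^i_{11} + v^i_{22} + (F v)^i + β z_2`. -/
def reducedVorticity {m : ℕ} (F : Matrix (Fin m) (Fin m) ℝ) (β : ℝ) (i : Fin m) :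
    Jet 2 m → ℝ := fun p =>
  p.2 i ![2, 0] + p.2 i ![0, 2] + (F.mulVec fun j => p.2 j 0) i + β * p.1 1

/-- The left-hand sides of the reduced system `{v^i, w^i} + (F c)^i + a β = 0`. -/
def reducedSystem {m : ℕ} (F : Matrix (Fin m) (Fin m) ℝ) (β a : ℝ) (c : Fin m → ℝ) (i : Fin m) :
    Jet 2 m → ℝ := fun p =>
  poisson 0 1 (fun p => p.2 i 0) (reducedVorticity F β i) p + F.mulVec c i + a * β

/-- The vector fields on `U`, in the space of the variables `(z, v)`, that are induced by the
maximal Lie invariance algebra `g` of the model: the images under the invariants of the elements of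
the normalizer in `g` of the reduction subalgebra. -/
def inducedAlgebra {m : ℕ} (F : Matrix (Fin m) (Fin m) ℝ) (β a : ℝ) (c : Fin m → ℝ)
    (U : Set (Base 2 m)) : Set (VectorFieldOn 2 m) :=
  {R | ∃ Q ∈ normalizer (maxLieInvarianceAlgebra (model F β) (invariants a c ⁻¹' U))
        (Submodule.span ℝ {generator a c}) (invariants a c ⁻¹' U),
      ∀ P ∈ invariants a c ⁻¹' U, fderiv ℝ (invariants a c) P (Q P) = R (invariants a c P)}

end QG

end

/-!
Over a point `b`, prescribe the gradients of the `u^i`, let the second order derivatives vanish and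
use the third order derivatives to solve the reduced system. The criterion for a vector field `Q` is
affine in the remaining third order derivatives, so its linear part vanishes, which forces the
derivative of `Q` at `b` to be an infinitesimal conformal map of the independent variables plus a
diagonal map of the dependent ones. What is left of the criterion is polynomial in the gradients,
and along the coordinate axes its odd part involves no higher derivatives of `Q`: since `β ≠ 0`, the
rotation vanishes and the diagonal entries are all equal to three times the scaling, while one
nonzero coupling makes two of these entries differ by twice the scaling. Hence `Q` is locally
constant.

Conversely, the constant vector fields are symmetries and are induced by constant symmetries of the
model. Every induced vector field is a symmetry because the ansatz lifts the jets of `v` that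
satisfy the reduced system to jets of `ψ` that satisfy the model, compatibly with prolongation.
-/

noncomputable section

namespace QG

section Calculus

variable {E W W' : Type*} [NormedAddCommGroup E] [NormedSpace ℝ E] [NormedAddCommGroup W]
  [NormedSpace ℝ W] [NormedAddCommGroup W'] [NormedSpace ℝ W'] {U : Set E} {b : E}

theorem fderiv_fderiv_symm (hU : IsOpen U) {G : E → W} (hG : ContDiffOn ℝ ∞ G U) (hb : b ∈ U)
    (x y : E) : fderiv ℝ (fderiv ℝ G) b x y = fderiv ℝ (fderiv ℝ G) b y x :=
  ((hG.contDiffAt (hU.mem_nhds hb)).isSymmSndFDerivAt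
    (by simpa using WithTop.coe_le_coe.2 (le_top : (2 : ℕ∞) ≤ ⊤))) x y

theorem clm_fderiv_apply_eq_zero (hU : IsOpen U) {A : E → W} (hA : ContDiffOn ℝ ∞ A U)
    (L : W →L[ℝ] W') (hL : ∀ b ∈ U, L (A b) = 0) (hb : b ∈ U) (x : E) :
    L (fderiv ℝ A b x) = 0 := by
  have hd : DifferentiableAt ℝ A b := (hA.contDiffAt (hU.mem_nhds hb)).differentiableAt (by simp)
  have h₀ : L ∘ A =ᶠ[nhds b] 0 := Filter.eventually_of_mem (hU.mem_nhds hb) hL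
  have h : HasFDerivAt (L ∘ A) (L.comp (fderiv ℝ A b)) b := L.hasFDerivAt.comp b hd.hasFDerivAt
  exact congrArg (fun M => M x) (h.unique ((hasFDerivAt_const 0 b).congr_of_eventuallyEq h₀))

theorem clm_fderiv_fderiv_fderiv_apply_eq_zero (hU : IsOpen U) {G : E → W}
    (hG : ContDiffOn ℝ ∞ G U) (L : W →L[ℝ] W') {z : E} (hL : ∀ b ∈ U, L (fderiv ℝ G b z) = 0)
    (hb : b ∈ U) (x y : E) :
    L (fderiv ℝ (fderiv ℝ (fderiv ℝ G)) b x y z) = 0 ∧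
      L (fderiv ℝ (fderiv ℝ (fderiv ℝ G)) b x z y) = 0 ∧
      L (fderiv ℝ (fderiv ℝ (fderiv ℝ G)) b z x y) = 0 := by
  have hG₁ : ContDiffOn ℝ ∞ (fderiv ℝ G) U := hG.fderiv_of_isOpen hU (by simp)
  have hG₂ : ContDiffOn ℝ ∞ (fderiv ℝ (fderiv ℝ G)) U := hG₁.fderiv_of_isOpen hU (by simp)
  have h₂ (y : E) : ∀ b ∈ U, L (fderiv ℝ (fderiv ℝ G) b y z) = 0 := fun _ hb =>
    clm_fderiv_apply_eq_zero hU hG₁ (L.comp (ContinuousLinearMap.apply ℝ W z)) hL hb y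
  have h₃ (y z : E) (h : ∀ b ∈ U, L (fderiv ℝ (fderiv ℝ G) b y z) = 0) (x : E) :
      L (fderiv ℝ (fderiv ℝ (fderiv ℝ G)) b x y z) = 0 :=
    clm_fderiv_apply_eq_zero hU hG₂ ((L.comp (ContinuousLinearMap.apply ℝ W z)).comp
      (ContinuousLinearMap.apply ℝ (E →L[ℝ] W) y)) h hb x
  have hxzy := h₃ z y (fun b hb => by rw [fderiv_fderiv_symm hU hG hb, h₂ y b hb])
  exact ⟨h₃ y z (h₂ y) x, hxzy x, by rw [fderiv_fderiv_symm hU hG₁ hb, hxzy x]⟩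

end Calculus

/-! ### Calculus of total derivatives -/

section TotalDerivatives

variable {n m : ℕ} {W W' : Type*} [NormedAddCommGroup W] [NormedSpace ℝ W]
  [NormedAddCommGroup W'] [NormedSpace ℝ W'] {U : Set (Base n m)} {μ : Fin n}

/-- The total derivative `D_μ` as a tangent vector of the jet space at `p`. -/
def totalVec (μ : Fin n) (p : Jet n m) : Jet n m :=
  (Pi.single μ 1, fun j α => p.2 j (α + unitIndex μ))

/-- The first order derivatives `u^j_μ` of a jet. -/
def gradient (p : Jet n m) (μ : Fin n) (j : Fin m) : ℝ := p.2 j (unitIndex μ)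

/-- The vector `∂_{x_μ} + ∑_j g^j_μ ∂_{u^j}`, tangent to the graphs of the functions with the
gradient `g`. -/
def tangent (g : Fin n → Fin m → ℝ) (μ : Fin n) : Base n m := (Pi.single μ 1, g μ)

/-- The vertical vector `∑_j u^j_α ∂_{u^j}`. -/
def vertical (α : Fin n → ℕ) (p : Jet n m) : Base n m := (0, fun j => p.2 j α)

theorem base_totalVec (μ : Fin n) (p : Jet n m) : base (totalVec μ p) = tangent (gradient p) μ := by
  simp only [base, totalVec, tangent, zero_add]
  rfl

theorem eventually_base_add_smul_mem (hU : IsOpen U) {p : Jet n m} (hp : base p ∈ U)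
    (V : Jet n m) : ∀ᶠ s : ℝ in nhds 0, base (p + s • V) ∈ U := by
  have hc : Continuous fun s : ℝ => base p + s • base V := by fun_prop
  exact hc.continuousAt.eventually_mem (hU.mem_nhds (by simpa using hp))

/-- The total derivative `D_μ A` exists over `U` and equals `B`; unlike `totalDeriv`, this makes
sense for vector-valued `A` and excludes the junk value of the derivative. -/
def HasTotalDeriv (U : Set (Base n m)) (μ : Fin n) (A B : Jet n m → W) : Prop :=
  ∀ p, base p ∈ U → HasLineDerivAt ℝ A (B p) p (totalVec μ p)

theorem totalDeriv_congr (hU : IsOpen U) {A A' : Jet n m → ℝ}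
    (hA : ∀ p, base p ∈ U → A p = A' p) {p : Jet n m} (hp : base p ∈ U) :
    totalDeriv μ A p = totalDeriv μ A' p :=
  Filter.EventuallyEq.deriv_eq ((eventually_base_add_smul_mem hU hp _).mono fun _ hs => hA _ hs)

namespace HasTotalDeriv

theorem totalDeriv_eq {A B : Jet n m → ℝ} (h : HasTotalDeriv U μ A B) {p : Jet n m}
    (hp : base p ∈ U) : totalDeriv μ A p = B p :=
  (h p hp).lineDeriv

theorem congr (hU : IsOpen U) {A A' B : Jet n m → W} (h : HasTotalDeriv U μ A B)
    (hA : ∀ p, base p ∈ U → A' p = A p) : HasTotalDeriv U μ A' B := fun p hp =>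
  HasDerivAt.congr_of_eventuallyEq (h p hp)
    ((eventually_base_add_smul_mem hU hp _).mono fun _ hs => hA _ hs)

theorem add {A B A' B' : Jet n m → W} (h : HasTotalDeriv U μ A B) (h' : HasTotalDeriv U μ A' B') :
    HasTotalDeriv U μ (fun p => A p + A' p) (fun p => B p + B' p) :=
  fun p hp => HasDerivAt.add (h p hp) (h' p hp)

theorem sub {A B A' B' : Jet n m → W} (h : HasTotalDeriv U μ A B) (h' : HasTotalDeriv U μ A' B') :
    HasTotalDeriv U μ (fun p => A p - A' p) (fun p => B p - B' p) :=
  fun p hp => HasDerivAt.sub (h p hp) (h' p hp)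

theorem sum {ι : Type*} (s : Finset ι) {A B : ι → Jet n m → W}
    (h : ∀ i ∈ s, HasTotalDeriv U μ (A i) (B i)) :
    HasTotalDeriv U μ (fun p => ∑ i ∈ s, A i p) (fun p => ∑ i ∈ s, B i p) :=
  fun p hp => HasDerivAt.fun_sum fun i hi => h i hi p hp

theorem mul {A B A' B' : Jet n m → ℝ} (h : HasTotalDeriv U μ A B)
    (h' : HasTotalDeriv U μ A' B') :
    HasTotalDeriv U μ (fun p => A p * A' p) (fun p => B p * A' p + A p * B' p) :=
  fun p hp => by
    have := HasDerivAt.mul (h p hp) (h' p hp)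
    simp only [zero_smul, add_zero] at this
    exact this

theorem const_mul (r : ℝ) {A B : Jet n m → ℝ} (h : HasTotalDeriv U μ A B) :
    HasTotalDeriv U μ (fun p => r * A p) (fun p => r * B p) :=
  fun p hp => HasDerivAt.const_mul r (h p hp)

theorem clm_apply {A B : Jet n m → W →L[ℝ] W'} {A' B' : Jet n m → W}
    (h : HasTotalDeriv U μ A B) (h' : HasTotalDeriv U μ A' B') :
    HasTotalDeriv U μ (fun p => A p (A' p)) (fun p => B p (A' p) + A p (B' p)) :=
  fun p hp => by
    have := HasDerivAt.clm_apply (h p hp) (h' p hp)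
    simp only [zero_smul, add_zero] at this
    exact this

theorem clm_comp (L : W →L[ℝ] W') {A B : Jet n m → W} (h : HasTotalDeriv U μ A B) :
    HasTotalDeriv U μ (fun p => L (A p)) (fun p => L (B p)) :=
  fun p hp => L.hasFDerivAt.comp_hasDerivAt (0 : ℝ) (h p hp)

end HasTotalDeriv

theorem hasTotalDeriv_coord (μ : Fin n) (j : Fin m) (α : Fin n → ℕ) :
    HasTotalDeriv U μ (fun p => p.2 j α) (fun p => p.2 j (α + unitIndex μ)) := fun p _ => by
  have := ((hasDerivAt_id (0 : ℝ)).mul_const (p.2 j (α + unitIndex μ))).const_add (p.2 j α)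
  simpa [HasLineDerivAt, totalVec] using this

theorem hasTotalDeriv_vertical (μ : Fin n) (α : Fin n → ℕ) :
    HasTotalDeriv U μ (vertical (m := m) α) (vertical (α + unitIndex μ)) := fun p hp =>
  HasDerivAt.prodMk (hasDerivAt_const _ _) (hasDerivAt_pi.2 fun j => hasTotalDeriv_coord μ j α p hp)

theorem hasTotalDeriv_tangent (ν μ : Fin n) :
    HasTotalDeriv U ν (fun p : Jet n m => tangent (gradient p) μ)
      (vertical (unitIndex μ + unitIndex ν)) := fun p hp =>
  HasDerivAt.prodMk (hasDerivAt_const _ _)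
    (hasDerivAt_pi.2 fun j => hasTotalDeriv_coord ν j (unitIndex μ) p hp)

theorem hasTotalDeriv_comp_base {G : Base n m → W} (hG : ∀ b ∈ U, DifferentiableAt ℝ G b)
    (μ : Fin n) :
    HasTotalDeriv U μ (fun p => G (base p))
      (fun p => fderiv ℝ G (base p) (tangent (gradient p) μ)) := by
  intro p hp
  simp only [← base_totalVec]
  exact HasFDerivAt.hasLineDerivAt (hG _ hp).hasFDerivAt (base (totalVec μ p))

/-! ### Total derivatives of functions of `(x, u)` -/

/-- The first total derivative `D_μ G` of a function `G(x, u)`. -/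
def total₁ (G : Base n m → W) (μ : Fin n) (p : Jet n m) : W :=
  fderiv ℝ G (base p) (tangent (gradient p) μ)

/-- The second total derivative `D_ν D_μ G` of a function `G(x, u)`. -/
def total₂ (G : Base n m → W) (ν μ : Fin n) (p : Jet n m) : W :=
  fderiv ℝ (fderiv ℝ G) (base p) (tangent (gradient p) ν) (tangent (gradient p) μ) +
    fderiv ℝ G (base p) (vertical (unitIndex μ + unitIndex ν) p)

/-- The third total derivative `D_κ D_ν D_μ G` of a function `G(x, u)`. -/
def total₃ (G : Base n m → W) (κ ν μ : Fin n) (p : Jet n m) : W :=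
  fderiv ℝ (fderiv ℝ (fderiv ℝ G)) (base p) (tangent (gradient p) κ) (tangent (gradient p) ν)
      (tangent (gradient p) μ) +
    fderiv ℝ (fderiv ℝ G) (base p) (vertical (unitIndex ν + unitIndex κ) p)
      (tangent (gradient p) μ) +
    fderiv ℝ (fderiv ℝ G) (base p) (tangent (gradient p) ν)
      (vertical (unitIndex μ + unitIndex κ) p) +
    (fderiv ℝ (fderiv ℝ G) (base p) (tangent (gradient p) κ)
        (vertical (unitIndex μ + unitIndex ν) p) +
      fderiv ℝ G (base p) (vertical (unitIndex μ + unitIndex ν + unitIndex κ) p))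

theorem hasTotalDeriv_base (hU : IsOpen U) {G : Base n m → W} (hG : ContDiffOn ℝ ∞ G U)
    (μ : Fin n) : HasTotalDeriv U μ (fun p => G (base p)) (total₁ G μ) :=
  hasTotalDeriv_comp_base
    (fun _ hb => (hG.contDiffAt (hU.mem_nhds hb)).differentiableAt (by simp)) μ

theorem hasTotalDeriv_total₁ (hU : IsOpen U) {G : Base n m → W} (hG : ContDiffOn ℝ ∞ G U)
    (ν μ : Fin n) : HasTotalDeriv U ν (total₁ G μ) (total₂ G ν μ) :=
  (hasTotalDeriv_base hU (hG.fderiv_of_isOpen hU (by simp)) ν).clm_apply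
    (hasTotalDeriv_tangent ν μ)

theorem hasTotalDeriv_total₂ (hU : IsOpen U) {G : Base n m → W} (hG : ContDiffOn ℝ ∞ G U)
    (κ ν μ : Fin n) : HasTotalDeriv U κ (total₂ G ν μ) (total₃ G κ ν μ) := by
  have hG' : ContDiffOn ℝ ∞ (fderiv ℝ G) U := hG.fderiv_of_isOpen hU (by simp)
  exact ((hasTotalDeriv_total₁ hU hG' κ ν).clm_apply (hasTotalDeriv_tangent κ μ)).add
    ((hasTotalDeriv_base hU hG' κ).clm_apply (hasTotalDeriv_vertical κ _))

theorem total₂_comm (hU : IsOpen U) {G : Base n m → W} (hG : ContDiffOn ℝ ∞ G U) (ν μ : Fin n)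
    {p : Jet n m} (hp : base p ∈ U) : total₂ G ν μ p = total₂ G μ ν p := by
  simp only [total₂]
  rw [fderiv_fderiv_symm hU hG hp (tangent (gradient p) ν), add_comm (unitIndex μ)]

/-! ### Differential polynomials -/

theorem tangent_eq_sum (g : Fin n → Fin m → ℝ) (μ : Fin n) :
    tangent g μ = (Pi.single μ 1, 0) + ∑ j, g μ j • ((0, Pi.single j 1) : Base n m) := by
  ext k
  · simp [tangent, Prod.fst_sum]
  · simp [tangent, Prod.snd_sum, Finset.sum_apply, Pi.single_apply]

/-- Over `U`, the function `A` on the jet space is a polynomial in the `u^j_α` whose coefficients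
are smooth functions of `(x, u)`. On this class, which contains the characteristics of smooth vector
fields, total derivatives exist and commute. -/
inductive IsDifferentialPolynomial (U : Set (Base n m)) : (Jet n m → ℝ) → Prop
  | ofBase {g : Base n m → ℝ} (hg : ContDiffOn ℝ ∞ g U) :
      IsDifferentialPolynomial U fun p => g (base p)
  | coord (j : Fin m) (α : Fin n → ℕ) : IsDifferentialPolynomial U fun p => p.2 j α
  | add {A A' : Jet n m → ℝ} (hA : IsDifferentialPolynomial U A)
      (hA' : IsDifferentialPolynomial U A') : IsDifferentialPolynomial U fun p => A p + A' p
  | mul {A A' : Jet n m → ℝ} (hA : IsDifferentialPolynomial U A)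
      (hA' : IsDifferentialPolynomial U A') : IsDifferentialPolynomial U fun p => A p * A' p
  | congr {A A' : Jet n m → ℝ} (hA : IsDifferentialPolynomial U A)
      (hAA' : ∀ p, base p ∈ U → A' p = A p) : IsDifferentialPolynomial U A'

theorem HasTotalDeriv.totalDeriv_totalDeriv_eq (hU : IsOpen U) {ν : Fin n} {A B C : Jet n m → ℝ}
    (hA : HasTotalDeriv U μ A B) (hB : HasTotalDeriv U ν B C) {p : Jet n m} (hp : base p ∈ U) :
    totalDeriv ν (totalDeriv μ A) p = C p :=
  (totalDeriv_congr hU (fun _ hq => hA.totalDeriv_eq hq) hp).trans (hB.totalDeriv_eq hp)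

namespace IsDifferentialPolynomial

theorem const (r : ℝ) : IsDifferentialPolynomial (n := n) (m := m) U fun _ => r :=
  ofBase (g := fun _ => r) contDiffOn_const

theorem sum {ι : Type*} (s : Finset ι) {A : ι → Jet n m → ℝ}
    (hA : ∀ i ∈ s, IsDifferentialPolynomial U (A i)) :
    IsDifferentialPolynomial U fun p => ∑ i ∈ s, A i p := by
  classical
  induction s using Finset.induction_on with
  | empty => exact const 0
  | insert i s hi ih =>
    simp only [Finset.sum_insert hi]
    exact (hA i (Finset.mem_insert_self i s)).add
      (ih fun k hk => hA k (Finset.mem_insert_of_mem hk))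

theorem sub {A A' : Jet n m → ℝ} (hA : IsDifferentialPolynomial U A)
    (hA' : IsDifferentialPolynomial U A') : IsDifferentialPolynomial U fun p => A p - A' p :=
  (hA.add ((const (-1)).mul hA')).congr fun _ _ => by ring

theorem total₁ (hU : IsOpen U) {g : Base n m → ℝ} (hg : ContDiffOn ℝ ∞ g U) (μ : Fin n) :
    IsDifferentialPolynomial U (total₁ g μ) := by
  have hg' (w : Base n m) : ContDiffOn ℝ ∞ (fun b => fderiv ℝ g b w) U :=
    (hg.fderiv_of_isOpen hU (by simp)).clm_apply contDiffOn_const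
  refine ((ofBase (hg' (Pi.single μ 1, 0))).add (sum Finset.univ fun j _ =>
    (coord j (unitIndex μ)).mul (ofBase (hg' (0, Pi.single j 1))))).congr fun p _ => ?_
  simp only [QG.total₁, tangent_eq_sum, map_add, map_sum, map_smul, smul_eq_mul]
  rfl

theorem exists_hasTotalDeriv (hU : IsOpen U) {A : Jet n m → ℝ} (hA : IsDifferentialPolynomial U A)
    (μ : Fin n) : ∃ B, IsDifferentialPolynomial U B ∧ HasTotalDeriv U μ A B := by
  induction hA with
  | ofBase hg => exact ⟨_, total₁ hU hg μ, hasTotalDeriv_base hU hg μ⟩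
  | coord j α => exact ⟨_, coord j _, hasTotalDeriv_coord μ j α⟩
  | add _ _ ih ih' =>
    obtain ⟨B, hB, h⟩ := ih
    obtain ⟨B', hB', h'⟩ := ih'
    exact ⟨_, hB.add hB', h.add h'⟩
  | mul hA hA' ih ih' =>
    obtain ⟨B, hB, h⟩ := ih
    obtain ⟨B', hB', h'⟩ := ih'
    exact ⟨_, (hB.mul hA').add (hA.mul hB'), h.mul h'⟩
  | congr _ hAA' ih =>
    obtain ⟨B, hB, h⟩ := ih
    exact ⟨B, hB, h.congr hU hAA'⟩

theorem totalDeriv (hU : IsOpen U) {A : Jet n m → ℝ} (hA : IsDifferentialPolynomial U A)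
    (μ : Fin n) : IsDifferentialPolynomial U (totalDeriv μ A) := by
  obtain ⟨B, hB, h⟩ := hA.exists_hasTotalDeriv hU μ
  exact hB.congr fun p hp => h.totalDeriv_eq hp

theorem hasTotalDeriv (hU : IsOpen U) {A : Jet n m → ℝ} (hA : IsDifferentialPolynomial U A)
    (μ : Fin n) : HasTotalDeriv U μ A (QG.totalDeriv μ A) := by
  obtain ⟨B, -, h⟩ := hA.exists_hasTotalDeriv hU μ
  exact fun p hp => (h.totalDeriv_eq hp).symm ▸ h p hp

theorem totalDeriv_comm (hU : IsOpen U) {A : Jet n m → ℝ} (hA : IsDifferentialPolynomial U A)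
    (ν μ : Fin n) {p : Jet n m} (hp : base p ∈ U) :
    QG.totalDeriv ν (QG.totalDeriv μ A) p = QG.totalDeriv μ (QG.totalDeriv ν A) p := by
  induction hA with
  | ofBase hg =>
    have expand (κ l : Fin n) :=
      (hasTotalDeriv_base hU hg κ).totalDeriv_totalDeriv_eq hU (hasTotalDeriv_total₁ hU hg l κ) hp
    rw [expand, expand, total₂_comm hU hg ν μ hp]
  | coord j α =>
    rw [(hasTotalDeriv_coord μ j α).totalDeriv_totalDeriv_eq hU (hasTotalDeriv_coord ν j _) hp,
      (hasTotalDeriv_coord ν j α).totalDeriv_totalDeriv_eq hU (hasTotalDeriv_coord μ j _) hp,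
      add_right_comm]
  | add hA hA' ih ih' =>
    have expand (κ l : Fin n) :=
      ((hA.hasTotalDeriv hU κ).add (hA'.hasTotalDeriv hU κ)).totalDeriv_totalDeriv_eq hU
        (((hA.totalDeriv hU κ).hasTotalDeriv hU l).add
          ((hA'.totalDeriv hU κ).hasTotalDeriv hU l)) hp
    rw [expand, expand, ih, ih']
  | mul hA hA' ih ih' =>
    have expand (κ l : Fin n) :=
      ((hA.hasTotalDeriv hU κ).mul (hA'.hasTotalDeriv hU κ)).totalDeriv_totalDeriv_eq hU
        ((((hA.totalDeriv hU κ).hasTotalDeriv hU l).mul (hA'.hasTotalDeriv hU l)).add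
          ((hA.hasTotalDeriv hU l).mul ((hA'.totalDeriv hU κ).hasTotalDeriv hU l))) hp
    rw [expand, expand, ih, ih']
    ring
  | congr _ hAA' ih =>
    have expand (κ l : Fin n) :=
      totalDeriv_congr (μ := l) hU (fun q hq => totalDeriv_congr (μ := κ) hU hAA' hq) hp
    rw [expand, expand, ih]

theorem characteristic {Q : VectorFieldOn n m} (hQ : ContDiffOn ℝ ∞ Q U) (j : Fin m) :
    IsDifferentialPolynomial U (characteristic Q j) :=
  (ofBase (contDiffOn_pi.1 hQ.snd j)).sub (sum Finset.univ fun μ _ =>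
    (ofBase (contDiffOn_pi.1 hQ.fst μ)).mul (coord j (unitIndex μ)))

end IsDifferentialPolynomial

/-! ### Prolongations up to the third order -/

/-- The contact form `du^j - ∑_l u^j_l dx^l` at a jet with the gradient `g`. -/
def contactForm (g : Fin n → Fin m → ℝ) (j : Fin m) : Base n m →L[ℝ] ℝ :=
  (ContinuousLinearMap.proj j).comp (ContinuousLinearMap.snd ℝ (Fin n → ℝ) (Fin m → ℝ)) -
    ∑ l, g l j • (ContinuousLinearMap.proj l).comp (ContinuousLinearMap.fst ℝ _ _)

theorem contactForm_apply (g : Fin n → Fin m → ℝ) (j : Fin m) (w : Base n m) :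
    contactForm g j w = w.2 j - ∑ l, w.1 l * g l j := by
  simp [contactForm, mul_comm]

/-- The `u^j_α`-component `∑_l ξ^l u^j_{α + e_l}` of the horizontal vector field `∑_l ξ^l D_l`,
where `ξ` is the horizontal part of `w`. -/
def horizontal (j : Fin m) (α : Fin n → ℕ) (p : Jet n m) (w : Base n m) : ℝ :=
  ∑ l, w.1 l * p.2 j (α + unitIndex l)

theorem contactForm_gradient_apply (p : Jet n m) (j : Fin m) (w : Base n m) :
    contactForm (gradient p) j w = w.2 j - horizontal j 0 p w := by
  simp only [contactForm_apply, horizontal, zero_add, gradient]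

namespace HasTotalDeriv

theorem snd_apply {A B : Jet n m → Base n m} (h : HasTotalDeriv U μ A B) (j : Fin m) :
    HasTotalDeriv U μ (fun p => (A p).2 j) (fun p => (B p).2 j) :=
  h.clm_comp ((ContinuousLinearMap.proj j).comp (ContinuousLinearMap.snd ℝ _ _))

theorem fst_apply {A B : Jet n m → Base n m} (h : HasTotalDeriv U μ A B) (l : Fin n) :
    HasTotalDeriv U μ (fun p => (A p).1 l) (fun p => (B p).1 l) :=
  h.clm_comp ((ContinuousLinearMap.proj l).comp (ContinuousLinearMap.fst ℝ _ _))

theorem horizontal {A B : Jet n m → Base n m} (h : HasTotalDeriv U μ A B) (j : Fin m)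
    (α : Fin n → ℕ) : HasTotalDeriv U μ (fun p => horizontal j α p (A p))
      (fun p => QG.horizontal j α p (B p) + QG.horizontal j (α + unitIndex μ) p (A p)) := by
  have := sum Finset.univ fun l _ => (h.fst_apply l).mul
    (hasTotalDeriv_coord μ j (α + unitIndex l))
  simpa only [QG.horizontal, Finset.sum_add_distrib, add_right_comm α _ (unitIndex μ)] using this

end HasTotalDeriv

variable {Q : VectorFieldOn n m}

theorem hasTotalDeriv_characteristic (hU : IsOpen U) (hQ : ContDiffOn ℝ ∞ Q U) (j : Fin m)
    (μ : Fin n) : HasTotalDeriv U μ (characteristic Q j) fun p =>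
      (total₁ Q μ p).2 j -
        (horizontal j 0 p (total₁ Q μ p) + horizontal j (unitIndex μ) p (Q (base p))) := by
  have hQ₀ := hasTotalDeriv_base hU hQ μ
  simpa only [zero_add] using ((hQ₀.snd_apply j).sub (hQ₀.horizontal j 0)).congr hU fun p _ => by
    rw [← contactForm_gradient_apply, contactForm_apply]; rfl

theorem hasTotalDeriv_totalDeriv_characteristic (hU : IsOpen U) (hQ : ContDiffOn ℝ ∞ Q U)
    (j : Fin m) (ν μ : Fin n) : HasTotalDeriv U ν (totalDeriv μ (characteristic Q j)) fun p =>
      (total₂ Q ν μ p).2 j -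
        (horizontal j 0 p (total₂ Q ν μ p) + horizontal j (unitIndex ν) p (total₁ Q μ p) +
          (horizontal j (unitIndex μ) p (total₁ Q ν p) +
            horizontal j (unitIndex μ + unitIndex ν) p (Q (base p)))) := by
  have hQ₁ := hasTotalDeriv_total₁ hU hQ ν μ
  have h := (hQ₁.snd_apply j).sub ((hQ₁.horizontal j 0).add
    ((hasTotalDeriv_base hU hQ ν).horizontal j (unitIndex μ)))
  simpa only [zero_add] using
    h.congr hU fun p hp => (hasTotalDeriv_characteristic hU hQ j μ).totalDeriv_eq hp

theorem totalDeriv₃_characteristic (hU : IsOpen U) (hQ : ContDiffOn ℝ ∞ Q U) (j : Fin m)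
    (κ ν μ : Fin n) {p : Jet n m} (hp : base p ∈ U) :
    totalDeriv κ (totalDeriv ν (totalDeriv μ (characteristic Q j))) p =
      contactForm (gradient p) j (total₃ Q κ ν μ p) -
        horizontal j (unitIndex κ) p (total₂ Q ν μ p) -
        horizontal j (unitIndex ν) p (total₂ Q κ μ p) -
        horizontal j (unitIndex μ) p (total₂ Q κ ν p) -
        horizontal j (unitIndex ν + unitIndex κ) p (total₁ Q μ p) -
        horizontal j (unitIndex μ + unitIndex κ) p (total₁ Q ν p) -
        horizontal j (unitIndex μ + unitIndex ν) p (total₁ Q κ p) -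
        horizontal j (unitIndex μ + unitIndex ν + unitIndex κ) p (Q (base p)) := by
  have hQ₂ := hasTotalDeriv_total₂ hU hQ κ ν μ
  have h := (hQ₂.snd_apply j).sub (((hQ₂.horizontal j 0).add
    ((hasTotalDeriv_total₁ hU hQ κ μ).horizontal j (unitIndex ν))).add
    (((hasTotalDeriv_total₁ hU hQ κ ν).horizontal j (unitIndex μ)).add
      ((hasTotalDeriv_base hU hQ κ).horizontal j (unitIndex μ + unitIndex ν))))
  rw [(hasTotalDeriv_totalDeriv_characteristic hU hQ j ν μ).totalDeriv_totalDeriv_eq hU h hp,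
    contactForm_gradient_apply]
  simp only [zero_add]
  ring

theorem prolongation_unitIndex (hU : IsOpen U) (hQ : ContDiffOn ℝ ∞ Q U) {p : Jet n m}
    (hp : base p ∈ U) (j : Fin m) {μ : Fin n}
    (hμ : ∀ A : Jet n m → ℝ, totalDerivs (unitIndex μ) A = totalDeriv μ A) :
    (prolongation Q p).2 j (unitIndex μ) = contactForm (gradient p) j (total₁ Q μ p) := by
  simp only [prolongation, hμ, (hasTotalDeriv_characteristic hU hQ j μ).totalDeriv_eq hp,
    contactForm_gradient_apply, horizontal]
  ring

theorem prolongation_third (hU : IsOpen U) (hQ : ContDiffOn ℝ ∞ Q U) {p : Jet n m}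
    (hp : base p ∈ U) (h₂ : ∀ j μ ν, p.2 j (unitIndex μ + unitIndex ν) = 0) (j : Fin m)
    {α : Fin n → ℕ} {κ ν μ : Fin n} (hα : unitIndex μ + unitIndex ν + unitIndex κ = α)
    (hD : ∀ A : Jet n m → ℝ, totalDerivs α A = totalDeriv κ (totalDeriv ν (totalDeriv μ A))) :
    (prolongation Q p).2 j α = contactForm (gradient p) j
        (fderiv ℝ (fderiv ℝ (fderiv ℝ Q)) (base p) (tangent (gradient p) κ) (tangent (gradient p) ν)
          (tangent (gradient p) μ) + fderiv ℝ Q (base p) (vertical α p)) -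
      horizontal j (unitIndex ν + unitIndex κ) p (total₁ Q μ p) -
      horizontal j (unitIndex μ + unitIndex κ) p (total₁ Q ν p) -
      horizontal j (unitIndex μ + unitIndex ν) p (total₁ Q κ p) := by
  have hH (l : Fin n) (w : Base n m) : horizontal j (unitIndex l) p w = 0 := by
    simp [horizontal, h₂]
  have hv (l k : Fin n) : vertical (unitIndex l + unitIndex k) p = 0 := by
    simp [vertical, h₂]; rfl
  subst hα
  have hT : total₃ Q κ ν μ p = fderiv ℝ (fderiv ℝ (fderiv ℝ Q)) (base p) (tangent (gradient p) κ)
      (tangent (gradient p) ν) (tangent (gradient p) μ) +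
        fderiv ℝ Q (base p) (vertical (unitIndex μ + unitIndex ν + unitIndex κ) p) := by
    simp [total₃, hv]
  simp only [prolongation, hD, totalDeriv₃_characteristic hU hQ j κ ν μ hp, hH, hT]
  simp only [horizontal]
  ring

end TotalDerivatives

section ReducedSystem

variable {m : ℕ} {F : Matrix (Fin m) (Fin m) ℝ} {β a : ℝ} {c : Fin m → ℝ} {U : Set (Base 2 m)}
  {Q : VectorFieldOn 2 m} {b : Base 2 m}

/-! ### The invariance criterion at jets with vanishing second order derivatives -/

/-- The gradient of the Laplacian of `u^i` in terms of the third order coordinates of a jet. -/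
def laplacianGradient (p : Jet 2 m) (i : Fin m) : Fin 2 → ℝ :=
  ![p.2 i ![3, 0] + p.2 i ![1, 2], p.2 i ![2, 1] + p.2 i ![0, 3]]

theorem totalDeriv_coord {n : ℕ} (μ : Fin n) (j : Fin m) (α : Fin n → ℕ) (p : Jet n m) :
    totalDeriv μ (fun p => p.2 j α) p = p.2 j (α + unitIndex μ) :=
  (hasTotalDeriv_coord (U := Set.univ) μ j α).totalDeriv_eq trivial

theorem hasTotalDeriv_mulVec {n : ℕ} {U : Set (Base n m)} (F : Matrix (Fin m) (Fin m) ℝ)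
    (i : Fin m) (μ : Fin n) :
    HasTotalDeriv U μ (fun p => (F.mulVec fun j => p.2 j 0) i)
      (fun p => F.mulVec (gradient p μ) i) := by
  have := HasTotalDeriv.sum (U := U) Finset.univ fun j _ =>
    (hasTotalDeriv_coord μ j (0 : Fin n → ℕ)).const_mul (F i j)
  simpa only [zero_add, Matrix.mulVec, dotProduct, gradient] using this

theorem hasTotalDeriv_x {n : ℕ} {U : Set (Base n m)} (μ ν : Fin n) :
    HasTotalDeriv U μ (fun p => p.1 ν) (fun _ => (Pi.single μ 1 : Fin n → ℝ) ν) := by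
  intro p _
  have := ((hasDerivAt_id (0 : ℝ)).mul_const ((Pi.single μ 1 : Fin n → ℝ) ν)).const_add (p.1 ν)
  simpa [HasLineDerivAt, totalVec] using this

theorem totalDeriv_reducedVorticity (F : Matrix (Fin m) (Fin m) ℝ) (β : ℝ) (i : Fin m) (μ : Fin 2)
    (p : Jet 2 m) : totalDeriv μ (reducedVorticity F β i) p =
      laplacianGradient p i μ + F.mulVec (gradient p μ) i +
        β * (Pi.single μ 1 : Fin 2 → ℝ) 1 := by
  have h : HasTotalDeriv Set.univ μ (reducedVorticity F β i) _ :=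
    (((hasTotalDeriv_coord μ i ![2, 0]).add (hasTotalDeriv_coord μ i ![0, 2])).add
      (hasTotalDeriv_mulVec F i μ)).add ((hasTotalDeriv_x μ 1).const_mul β)
  refine (h.totalDeriv_eq trivial).trans ?_
  congr 2
  fin_cases μ
  · exact congrArg₂ (fun α γ => p.2 i α + p.2 i γ) (by decide) (by decide)
  · exact congrArg₂ (fun α γ => p.2 i α + p.2 i γ) (by decide) (by decide)

theorem reducedSystem_apply (F : Matrix (Fin m) (Fin m) ℝ) (β a : ℝ) (c : Fin m → ℝ) (i : Fin m)
    (p : Jet 2 m) :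
    reducedSystem F β a c i p =
      gradient p 0 i * (laplacianGradient p i 1 + F.mulVec (gradient p 1) i + β) -
        gradient p 1 i * (laplacianGradient p i 0 + F.mulVec (gradient p 0) i) +
        F.mulVec c i + a * β := by
  simp [reducedSystem, poisson, totalDeriv_coord, totalDeriv_reducedVorticity, gradient]

theorem lineDeriv_reducedSystem (F : Matrix (Fin m) (Fin m) ℝ) (β a : ℝ) (c : Fin m → ℝ)
    (i : Fin m) (p V : Jet 2 m) :
    lineDeriv ℝ (reducedSystem F β a c i) p V =
      gradient V 0 i * (laplacianGradient p i 1 + F.mulVec (gradient p 1) i + β) +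
        gradient p 0 i * (laplacianGradient V i 1 + F.mulVec (gradient V 1) i) -
        (gradient V 1 i * (laplacianGradient p i 0 + F.mulVec (gradient p 0) i) +
          gradient p 1 i * (laplacianGradient V i 0 + F.mulVec (gradient V 0) i)) := by
  have line (r s : ℝ) : HasDerivAt (fun t : ℝ => r + t * s) s 0 := by
    simpa using ((hasDerivAt_id (0 : ℝ)).mul_const s).const_add r
  have hg (μ : Fin 2) : HasDerivAt (fun t : ℝ => gradient (p + t • V) μ i) (gradient V μ i) 0 :=
    line _ _
  have hL (μ : Fin 2) : HasDerivAt (fun t : ℝ => laplacianGradient (p + t • V) i μ)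
      (laplacianGradient V i μ) 0 := by
    fin_cases μ <;> exact (line _ _).add (line _ _)
  have hF (μ : Fin 2) : HasDerivAt (fun t : ℝ => F.mulVec (gradient (p + t • V) μ) i)
      (F.mulVec (gradient V μ) i) 0 :=
    HasDerivAt.fun_sum (u := Finset.univ) fun j _ =>
      (line (gradient p μ j) (gradient V μ j)).const_mul (F i j)
  have h : HasLineDerivAt ℝ (reducedSystem F β a c i) _ p V :=
    (((((hg 0).mul (((hL 1).add (hF 1)).add_const β)).sub
      ((hg 1).mul ((hL 0).add (hF 0)))).add_const (F.mulVec c i)).add_const (a * β)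
      ).congr_of_eventuallyEq (.of_forall fun t => reducedSystem_apply F β a c i _)
  rw [h.lineDeriv]
  simp

/-- The jet over `b` with the gradient `g`, the third order derivatives `t 0, t 1, t 2, t 3`, where
`t k` is differentiated `k` times with respect to the second variable, and all other derivatives
zero. -/
def cubicJet (b : Base 2 m) (g : Fin 2 → Fin m → ℝ) (t : Fin 4 → Fin m → ℝ) : Jet 2 m :=
  (b.1, fun j α => match α 0, α 1 with
    | 0, 0 => b.2 j
    | 1, 0 => g 0 j
    | 0, 1 => g 1 j
    | 3, 0 => t 0 j
    | 2, 1 => t 1 j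
    | 1, 2 => t 2 j
    | 0, 3 => t 3 j
    | _, _ => 0)

/-- The part of the prolonged gradient of the Laplacian that is linear in the third order
derivatives `t` at a cubic jet with the gradient `g`, for a vector field with the derivative `D`. -/
def cubicSymbol (D : Base 2 m →L[ℝ] Base 2 m) (g : Fin 2 → Fin m → ℝ) (t : Fin 4 → Fin m → ℝ)
    (i : Fin m) : Fin 2 → ℝ :=
  let A (l μ : Fin 2) : ℝ := (D (tangent g μ)).1 l
  ![contactForm g i (D (0, t 0 + t 2)) - 3 * (A 0 0 * t 0 i + A 1 0 * t 1 i) -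
      (A 0 0 * t 2 i + A 1 0 * t 3 i) - 2 * (A 0 1 * t 1 i + A 1 1 * t 2 i),
    contactForm g i (D (0, t 1 + t 3)) - 2 * (A 0 0 * t 1 i + A 1 0 * t 2 i) -
      (A 0 1 * t 0 i + A 1 1 * t 1 i) - 3 * (A 0 1 * t 2 i + A 1 1 * t 3 i)]

/-- The part of the prolonged gradient of the Laplacian that involves the third derivatives of the
vector field `Q`, at a cubic jet over `b` with the gradient `g`. -/
def thirdDerivativeTerm (Q : VectorFieldOn 2 m) (b : Base 2 m) (g : Fin 2 → Fin m → ℝ)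
    (i : Fin m) : Fin 2 → ℝ :=
  let T := fderiv ℝ (fderiv ℝ (fderiv ℝ Q)) b
  let X := tangent g 0
  let Y := tangent g 1
  ![contactForm g i (T X X X + T X Y Y), contactForm g i (T X X Y + T Y Y Y)]

variable (b) (g : Fin 2 → Fin m → ℝ) (t : Fin 4 → Fin m → ℝ)

theorem base_cubicJet : base (cubicJet b g t) = b := rfl

theorem gradient_cubicJet : gradient (cubicJet b g t) = g := by
  funext μ j
  fin_cases μ <;> rfl

theorem cubicJet_second (j : Fin m) (μ ν : Fin 2) :
    (cubicJet b g t).2 j (unitIndex μ + unitIndex ν) = 0 := by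
  fin_cases μ <;> fin_cases ν <;> rfl

theorem cubicJet_third (j : Fin m) (κ ν μ : Fin 2) :
    (cubicJet b g t).2 j (unitIndex μ + unitIndex ν + unitIndex κ) =
      t ⟨μ + ν + κ, by omega⟩ j := by
  fin_cases μ <;> fin_cases ν <;> fin_cases κ <;> rfl

theorem gradient_prolongation_cubicJet (hU : IsOpen U) (hQ : ContDiffOn ℝ ∞ Q U) (hb : b ∈ U)
    (μ : Fin 2) (j : Fin m) : gradient (prolongation Q (cubicJet b g t)) μ j =
      contactForm g j (fderiv ℝ Q b (tangent g μ)) := by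
  rw [gradient, prolongation_unitIndex hU hQ (p := cubicJet b g t) hb j
    (by fin_cases μ <;> exact fun _ => rfl), total₁, gradient_cubicJet]
  rfl

theorem laplacianGradient_prolongation_cubicJet (hU : IsOpen U) (hQ : ContDiffOn ℝ ∞ Q U)
    (hb : b ∈ U) (i : Fin m) : laplacianGradient (prolongation Q (cubicJet b g t)) i =
      thirdDerivativeTerm Q b g i + cubicSymbol (fderiv ℝ Q b) g t i := by
  have hv (κ ν μ : Fin 2) : vertical (unitIndex μ + unitIndex ν + unitIndex κ) (cubicJet b g t) =
      (0, t ⟨μ + ν + κ, by omega⟩) :=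
    Prod.ext rfl (funext fun j => cubicJet_third b g t j κ ν μ)
  have third {α : Fin 2 → ℕ} (κ ν μ : Fin 2) (hα : unitIndex μ + unitIndex ν + unitIndex κ = α)
      (hD : ∀ A : Jet 2 m → ℝ, totalDerivs α A = totalDeriv κ (totalDeriv ν (totalDeriv μ A))) := by
    have h := prolongation_third hU hQ (p := cubicJet b g t) hb (cubicJet_second b g t) i hα hD
    simp only [← hα, hv, gradient_cubicJet, horizontal, total₁, Fin.sum_univ_two,
      cubicJet_third] at h
    exact hα ▸ h
  have h₃₀ := third (α := ![3, 0]) 0 0 0 (by decide) fun _ => rfl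
  have h₂₁ := third (α := ![2, 1]) 0 0 1 (by decide) fun _ => rfl
  have h₁₂ := third (α := ![1, 2]) 0 1 1 (by decide) fun _ => rfl
  have h₀₃ := third (α := ![0, 3]) 1 1 1 (by decide) fun _ => rfl
  rw [laplacianGradient, h₃₀, h₂₁, h₁₂, h₀₃, thirdDerivativeTerm, cubicSymbol]
  have vertical_add (v v' : Fin m → ℝ) : ((0, v + v') : Base 2 m) = (0, v) + (0, v') := by simp
  simp only [base_cubicJet, map_add, vertical_add, Matrix.cons_add_cons, Matrix.empty_add_empty,
    Fin.val_zero, Fin.val_one, Nat.add_zero, Nat.zero_add, Nat.reduceAdd, Fin.reduceFinMk,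
    Fin.zero_eta, Fin.mk_one]
  congr 1
  · ring
  · congr 1
    ring

variable (F β a c)

theorem reducedSystem_cubicJet (k : Fin m) : reducedSystem F β a c k (cubicJet b g t) =
    g 0 k * (t 1 k + t 3 k + F.mulVec (g 1) k + β) -
      g 1 k * (t 0 k + t 2 k + F.mulVec (g 0) k) + F.mulVec c k + a * β := by
  rw [reducedSystem_apply, gradient_cubicJet]
  rfl

theorem criterion_cubicJet (hU : IsOpen U)
    (hQ : Q ∈ maxLieInvarianceAlgebra (reducedSystem F β a c) U) (hb : b ∈ U)
    (hE : ∀ k, reducedSystem F β a c k (cubicJet b g t) = 0) (i : Fin m) :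
    let v (μ : Fin 2) (j : Fin m) : ℝ := contactForm g j (fderiv ℝ Q b (tangent g μ))
    let L : Fin 2 → ℝ := thirdDerivativeTerm Q b g i + cubicSymbol (fderiv ℝ Q b) g t i
    v 0 i * (t 1 i + t 3 i + F.mulVec (g 1) i + β) + g 0 i * (L 1 + F.mulVec (v 1) i) -
      (v 1 i * (t 0 i + t 2 i + F.mulVec (g 0) i) + g 1 i * (L 0 + F.mulVec (v 0) i)) = 0 := by
  have hL (k : Fin m) : laplacianGradient (cubicJet b g t) k = ![t 0 k + t 2 k, t 1 k + t 3 k] :=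
    rfl
  have h := hQ.2 (cubicJet b g t) hb hE i
  have hv (μ : Fin 2) := funext (gradient_prolongation_cubicJet b g t hU hQ.1 hb μ)
  rw [lineDeriv_reducedSystem, hv, hv, gradient_cubicJet, hL,
    laplacianGradient_prolongation_cubicJet b g t hU hQ.1 hb] at h
  exact h

theorem exists_reducedSystem_cubicJet_eq_zero (hg : ∀ k, g 0 k ^ 2 + g 1 k ^ 2 ≠ 0) :
    ∃ t, ∀ k, reducedSystem F β a c k (cubicJet b g t) = 0 := by
  let E (k : Fin m) : ℝ := g 0 k * (F.mulVec (g 1) k + β) - g 1 k * F.mulVec (g 0) k +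
    F.mulVec c k + a * β
  refine ⟨![fun k => E k * g 1 k / (g 0 k ^ 2 + g 1 k ^ 2), 0, 0,
    fun k => -E k * g 0 k / (g 0 k ^ 2 + g 1 k ^ 2)], fun k => ?_⟩
  suffices g 0 k * (-E k * g 0 k / (g 0 k ^ 2 + g 1 k ^ 2) + F.mulVec (g 1) k + β) -
      g 1 k * (E k * g 1 k / (g 0 k ^ 2 + g 1 k ^ 2) + F.mulVec (g 0) k) +
      F.mulVec c k + a * β = 0 by
    simpa [reducedSystem_cubicJet] using this
  have := hg k
  field_simp
  simp only [E]
  ring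

/-! ### Vector fields satisfying the criterion -/

theorem cubicSymbol_add (D : Base 2 m →L[ℝ] Base 2 m) (t t' : Fin 4 → Fin m → ℝ) (i : Fin m) :
    cubicSymbol D g (t + t') i = cubicSymbol D g t i + cubicSymbol D g t' i := by
  have vertical_add (k l : Fin 4) : ((0, t k + t' k + (t l + t' l)) : Base 2 m) =
      (0, t k + t l) + (0, t' k + t' l) :=
    Prod.ext (by simp) (by simp [add_add_add_comm])
  simp only [cubicSymbol, Pi.add_apply t t', vertical_add, map_add, Matrix.cons_add_cons,
    Matrix.empty_add_empty, Pi.add_apply]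
  congr 1
  · ring
  · congr 1
    ring

variable {F β a c b g}

theorem criterion_cubicSymbol (hU : IsOpen U)
    (hQ : Q ∈ maxLieInvarianceAlgebra (reducedSystem F β a c) U) (hb : b ∈ U)
    (hg : ∀ k, g 0 k ^ 2 + g 1 k ^ 2 ≠ 0)
    (ht : ∀ k, g 0 k * (t 1 k + t 3 k) = g 1 k * (t 0 k + t 2 k)) (i : Fin m) :
    contactForm g i (fderiv ℝ Q b (tangent g 0)) * (t 1 i + t 3 i) +
        g 0 i * cubicSymbol (fderiv ℝ Q b) g t i 1 =
      contactForm g i (fderiv ℝ Q b (tangent g 1)) * (t 0 i + t 2 i) +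
        g 1 i * cubicSymbol (fderiv ℝ Q b) g t i 0 := by
  -- The criteria at two solution jets that differ by `t` differ by the part linear in `t`.
  obtain ⟨s, hs⟩ := exists_reducedSystem_cubicJet_eq_zero F β a c b g hg
  have hst (k : Fin m) : reducedSystem F β a c k (cubicJet b g (t + s)) = 0 := by
    have := hs k
    rw [reducedSystem_cubicJet] at this ⊢
    simp only [Pi.add_apply]
    linear_combination this + ht k
  have h := criterion_cubicJet F β a c b g s hU hQ hb hs i
  have h' := criterion_cubicJet F β a c b g (t + s) hU hQ hb hst i
  simp only [cubicSymbol_add, Pi.add_apply] at h h'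
  linear_combination h' - h

theorem fderiv_vertical_single (hU : IsOpen U)
    (hQ : Q ∈ maxLieInvarianceAlgebra (reducedSystem F β a c) U) (hb : b ∈ U) {i j : Fin m}
    (hij : i ≠ j) :
    (fderiv ℝ Q b (0, Pi.single j 1)).1 = 0 ∧ (fderiv ℝ Q b (0, Pi.single j 1)).2 i = 0 := by
  obtain ⟨w, hw⟩ : ∃ w, fderiv ℝ Q b (0, Pi.single j 1) = w := ⟨_, rfl⟩
  have key (x y : ℝ) (hxy : x ^ 2 + y ^ 2 ≠ 0) : w.2 i - (w.1 0 * x + w.1 1 * y) = 0 := by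
    have hD (r : ℝ) : fderiv ℝ Q b (0, Pi.single j r) = r • w := by
      rw [← hw, ← map_smul]
      simp [← Pi.single_smul]
    -- Only the gradient of the vorticity of the layer `j` varies, along the gradient `(-y, x)` of
    -- `u^j`, which is orthogonal to the gradient `(x, y)` of `u^i`.
    have h := criterion_cubicSymbol ![Pi.single j (-y), 0, 0, Pi.single j x] (F := F) (β := β)
      (g := ![fun k => if k = i then x else if k = j then -y else 1,
        fun k => if k = i then y else if k = j then x else 0]) hU hQ hb
      (fun k => by
        by_cases hi : k = i
        · simpa [hi] using hxy
        · by_cases hj : k = j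
          · simpa [hi, hj, hij.symm, add_comm] using hxy
          · simp [hi, hj])
      (fun k => by
        by_cases hj : k = j
        · simp [hj, hij.symm, mul_comm]
        · simp [hj]) i
    simp only [cubicSymbol, contactForm_apply, hD, Pi.single_eq_of_ne hij, Fin.isValue, ↓reduceIte,
      Fin.sum_univ_two, Matrix.cons_val_zero, Matrix.cons_val_one, Matrix.cons_val,
      Matrix.cons_val', Matrix.cons_val_fin_one, Pi.zero_apply, Pi.neg_apply, Pi.smul_apply,
      Prod.fst_neg, Prod.snd_neg, Prod.smul_fst, Prod.smul_snd, smul_eq_mul, neg_smul, neg_mul,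
      mul_zero, add_zero, zero_add, sub_zero] at h
    exact (mul_eq_zero.1 (show (x ^ 2 + y ^ 2) * _ = 0 by linear_combination h)).resolve_left hxy
  have h₁ := key 1 0 (by norm_num)
  have h₂ := key (-1) 0 (by norm_num)
  have h₃ := key 0 1 (by norm_num)
  rw [hw]
  have hw₀ : w.1 0 = 0 := by linarith
  have hw₁ : w.1 1 = 0 := by linarith
  exact ⟨funext (Fin.forall_fin_two.2 ⟨hw₀, hw₁⟩), by linarith⟩

theorem exists_fderiv_vertical_eq [Nontrivial (Fin m)] (hU : IsOpen U)
    (hQ : Q ∈ maxLieInvarianceAlgebra (reducedSystem F β a c) U) (hb : b ∈ U) :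
    ∃ h : Fin m → ℝ, ∀ v, fderiv ℝ Q b (0, v) = (0, h * v) := by
  refine ⟨fun i => (fderiv ℝ Q b (0, Pi.single i 1)).2 i, fun v => ?_⟩
  have hv : ((0, v) : Base 2 m) = ∑ j, v j • (0, Pi.single j 1) := by
    ext k
    · simp [Prod.fst_sum]
    · simp [Prod.snd_sum, Finset.sum_apply, Pi.single_apply]
  rw [hv, map_sum]
  simp only [map_smul]
  ext k
  · simp only [Prod.fst_sum, Prod.smul_fst]
    refine congrFun (Finset.sum_eq_zero fun j _ => ?_) k
    obtain ⟨i, hi⟩ := exists_ne j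
    rw [(fderiv_vertical_single hU hQ hb hi).1, smul_zero]
  · simp only [Prod.snd_sum, Finset.sum_apply, Prod.smul_snd, Pi.smul_apply, Pi.mul_apply]
    rw [Finset.sum_eq_single k, smul_eq_mul, mul_comm]
    · exact fun j _ hj => by rw [(fderiv_vertical_single hU hQ hb hj.symm).2, smul_zero]
    · simp

/-- The linear map that acts on the independent variables as an infinitesimal conformal map, with
the scaling `θ` and the rotation `ρ`, and on the dependent variables as the diagonal map `h`. -/
def conformalDiagonal (θ ρ : ℝ) (h : Fin m → ℝ) (x : Base 2 m) : Base 2 m :=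
  (![θ * x.1 0 + ρ * x.1 1, θ * x.1 1 - ρ * x.1 0], h * x.2)

theorem exists_fderiv_eq_conformalDiagonal [Nontrivial (Fin m)] (hU : IsOpen U)
    (hQ : Q ∈ maxLieInvarianceAlgebra (reducedSystem F β a c) U) (hb : b ∈ U) :
    ∃ θ ρ h, ∀ x, fderiv ℝ Q b x = conformalDiagonal θ ρ h x := by
  obtain ⟨h, hh⟩ := exists_fderiv_vertical_eq hU hQ hb
  obtain ⟨A, hA⟩ : ∃ A : Fin 2 → Base 2 m, ∀ μ, fderiv ℝ Q b (Pi.single μ 1, 0) = A μ :=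
    ⟨_, fun _ => rfl⟩
  have split (x : Base 2 m) : x = x.1 0 • (Pi.single 0 1, 0) + x.1 1 • (Pi.single 1 1, 0) +
      (0, x.2) := by
    ext k
    · fin_cases k <;> simp
    · simp
  have hD (x : Base 2 m) : fderiv ℝ Q b x = x.1 0 • A 0 + x.1 1 • A 1 + (0, h * x.2) := by
    conv_lhs => rw [split x]
    simp only [map_add, map_smul, hA, hh]
  have key (i : Fin m) (x y s₀ s₁ s₂ s₃ : ℝ) (hxy : x ^ 2 + y ^ 2 ≠ 0)
      (hs : x * (s₁ + s₃) = y * (s₀ + s₂)) :=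
    criterion_cubicSymbol ![fun _ => s₀, fun _ => s₁, fun _ => s₂, fun _ => s₃]
      (g := ![fun _ => x, fun _ => y]) hU hQ hb (fun _ => hxy) (fun _ => hs) i
  simp only [cubicSymbol, contactForm_apply, tangent, hD, Fin.sum_univ_two, ne_eq, Fin.isValue,
    Matrix.cons_val_zero, Matrix.cons_val_one, Matrix.cons_val, Matrix.cons_val',
    Matrix.cons_val_fin_one, Pi.single_eq_same, one_smul, one_ne_zero, zero_ne_one,
    not_false_eq_true, Pi.single_eq_of_ne, zero_smul, add_zero, zero_add, Prod.snd_add,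
    Prod.fst_add, Pi.add_apply, Pi.mul_apply, Pi.zero_apply, zero_mul, sub_zero] at key
  have conformal (i : Fin m) : (A 1).1 1 = (A 0).1 0 ∧ (A 0).1 1 = -(A 1).1 0 ∧
      (A 0).2 i = 0 ∧ (A 1).2 i = 0 := by
    have h₁ := key i 1 0 0 1 0 (-1) (by norm_num) (by norm_num)
    have h₂ := key i 1 0 (-1) 0 1 0 (by norm_num) (by norm_num)
    have h₃ := key i 1 0 1 0 0 0 (by norm_num) (by norm_num)
    have h₄ := key i 0 1 0 0 0 1 (by norm_num) (by norm_num)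
    refine ⟨by linarith, by linarith, by linarith, by linarith⟩
  refine ⟨(A 0).1 0, (A 1).1 0, h, fun x => (hD x).trans (Prod.ext ?_ (funext fun i => ?_))⟩
  · obtain ⟨i, -⟩ := exists_pair_ne (Fin m)
    obtain ⟨h₁, h₂, -⟩ := conformal i
    refine funext (Fin.forall_fin_two.2 ⟨?_, ?_⟩)
    · change x.1 0 * (A 0).1 0 + x.1 1 * (A 1).1 0 + 0 = (A 0).1 0 * x.1 0 + (A 1).1 0 * x.1 1
      ring
    · change x.1 0 * (A 0).1 1 + x.1 1 * (A 1).1 1 + 0 = (A 0).1 0 * x.1 1 - (A 1).1 0 * x.1 0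
      rw [h₁, h₂]
      ring
  · simp [conformalDiagonal, conformal i]

section ConformalDiagonal

variable {θ ρ : ℝ} {h : Fin m → ℝ}

theorem contactForm_conformalDiagonal_tangent (g : Fin 2 → Fin m → ℝ) (i : Fin m) :
    contactForm g i (conformalDiagonal θ ρ h (tangent g 0)) = (h i - θ) * g 0 i + ρ * g 1 i ∧
      contactForm g i (conformalDiagonal θ ρ h (tangent g 1)) =
        (h i - θ) * g 1 i - ρ * g 0 i := by
  constructor <;>
  · simp only [contactForm_apply, conformalDiagonal, tangent, Fin.isValue, Pi.single_eq_same,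
      ne_eq, one_ne_zero, zero_ne_one, not_false_eq_true, Pi.single_eq_of_ne, mul_zero,
      Pi.mul_apply, Fin.sum_univ_two, Matrix.cons_val_zero, Matrix.cons_val_one,
      Matrix.cons_val_fin_one]
    ring

theorem cubicSymbol_conformalDiagonal {D : Base 2 m →L[ℝ] Base 2 m}
    (hD : ∀ x, D x = conformalDiagonal θ ρ h x) (g : Fin 2 → Fin m → ℝ) (t : Fin 4 → Fin m → ℝ)
    (i : Fin m) : cubicSymbol D g t i =
      ![(h i - 3 * θ) * (t 0 i + t 2 i) + ρ * (t 1 i + t 3 i),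
        (h i - 3 * θ) * (t 1 i + t 3 i) - ρ * (t 0 i + t 2 i)] := by
  simp only [cubicSymbol, hD, contactForm_apply, conformalDiagonal, tangent, Pi.zero_apply,
    Pi.mul_apply, Pi.add_apply, Fin.sum_univ_two, Matrix.cons_val_zero, Matrix.cons_val_one,
    Matrix.cons_val_fin_one, Pi.single_eq_same, ne_eq, one_ne_zero, zero_ne_one, not_false_eq_true,
    Pi.single_eq_of_ne, Matrix.vecCons_inj, and_true]
  constructor <;> ring

theorem criterion_conformalDiagonal (hU : IsOpen U)
    (hQ : Q ∈ maxLieInvarianceAlgebra (reducedSystem F β a c) U) (hb : b ∈ U)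
    (hD : ∀ x, fderiv ℝ Q b x = conformalDiagonal θ ρ h x)
    (hg : ∀ k, g 0 k ^ 2 + g 1 k ^ 2 ≠ 0) (i : Fin m) :
    -2 * (h i - 2 * θ) * (F.mulVec c i + a * β) -
        (h i - 2 * θ) * (g 0 i * F.mulVec (g 1) i - g 1 i * F.mulVec (g 0) i) +
        β * ((3 * θ - h i) * g 0 i + ρ * g 1 i) +
        (g 0 i * F.mulVec (h * g 1) i - g 1 i * F.mulVec (h * g 0) i) +
        (g 0 i * thirdDerivativeTerm Q b g i 1 - g 1 i * thirdDerivativeTerm Q b g i 0) = 0 := by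
  obtain ⟨t, ht⟩ := exists_reducedSystem_cubicJet_eq_zero F β a c b g hg
  have hcrit := criterion_cubicJet F β a c b g t hU hQ hb ht i
  have hv₀ : (fun j => (h j - θ) * g 0 j + ρ * g 1 j) = h * g 0 - θ • g 0 + ρ • g 1 := by
    ext j
    simp [sub_mul]
  have hv₁ : (fun j => (h j - θ) * g 1 j - ρ * g 0 j) = h * g 1 - θ • g 1 - ρ • g 0 := by
    ext j
    simp [sub_mul]
  have hE := ht i
  rw [reducedSystem_cubicJet] at hE
  simp only [hD, contactForm_conformalDiagonal_tangent, cubicSymbol_conformalDiagonal hD, hv₀, hv₁,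
    Matrix.mulVec_add, Matrix.mulVec_sub, Matrix.mulVec_smul, Pi.add_apply, Pi.sub_apply,
    Pi.smul_apply, smul_eq_mul, Matrix.cons_val_one, Matrix.cons_val_fin_one,
    Matrix.cons_val_zero] at hcrit
  linear_combination hcrit - 2 * (h i - 2 * θ) * hE

end ConformalDiagonal

theorem fderiv_fderiv_fderiv_snd_eq_zero [Nontrivial (Fin m)] (hU : IsOpen U)
    (hQ : Q ∈ maxLieInvarianceAlgebra (reducedSystem F β a c) U) (hb : b ∈ U) {i : Fin m}
    {z : Base 2 m} (hz : z.2 i = 0) (x y : Base 2 m) :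
    (fderiv ℝ (fderiv ℝ (fderiv ℝ Q)) b x y z).2 i = 0 ∧
      (fderiv ℝ (fderiv ℝ (fderiv ℝ Q)) b x z y).2 i = 0 ∧
      (fderiv ℝ (fderiv ℝ (fderiv ℝ Q)) b z x y).2 i = 0 :=
  clm_fderiv_fderiv_fderiv_apply_eq_zero hU hQ.1
    ((ContinuousLinearMap.proj i).comp (ContinuousLinearMap.snd ℝ (Fin 2 → ℝ) (Fin m → ℝ)))
    (fun b hb => by
      obtain ⟨θ, ρ, h, hD⟩ := exists_fderiv_eq_conformalDiagonal hU hQ hb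
      simp [hD, conformalDiagonal, hz]) hb x y

theorem fderiv_fderiv_fderiv_vertical_fst_eq_zero [Nontrivial (Fin m)] (hU : IsOpen U)
    (hQ : Q ∈ maxLieInvarianceAlgebra (reducedSystem F β a c) U) (hb : b ∈ U) (v : Fin m → ℝ)
    (x y : Base 2 m) :
    (fderiv ℝ (fderiv ℝ (fderiv ℝ Q)) b x y (0, v)).1 = 0 ∧
      (fderiv ℝ (fderiv ℝ (fderiv ℝ Q)) b x (0, v) y).1 = 0 ∧
      (fderiv ℝ (fderiv ℝ (fderiv ℝ Q)) b (0, v) x y).1 = 0 :=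
  clm_fderiv_fderiv_fderiv_apply_eq_zero hU hQ.1
    (ContinuousLinearMap.fst ℝ (Fin 2 → ℝ) (Fin m → ℝ))
    (fun b hb => by
      obtain ⟨θ, ρ, h, hD⟩ := exists_fderiv_eq_conformalDiagonal hU hQ hb
      simp [hD, conformalDiagonal]) hb x y

theorem fderiv_fderiv_fderiv_tangent_fst [Nontrivial (Fin m)] (hU : IsOpen U)
    (hQ : Q ∈ maxLieInvarianceAlgebra (reducedSystem F β a c) U) (hb : b ∈ U)
    (g : Fin 2 → Fin m → ℝ) (κ ν μ : Fin 2) :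
    (fderiv ℝ (fderiv ℝ (fderiv ℝ Q)) b (tangent g κ) (tangent g ν) (tangent g μ)).1 =
      (fderiv ℝ (fderiv ℝ (fderiv ℝ Q)) b (tangent 0 κ) (tangent 0 ν) (tangent 0 μ)).1 := by
  have split (μ : Fin 2) : tangent g μ = tangent 0 μ + (0, g μ) := by simp [tangent]
  rw [split κ, split ν, split μ]
  simp only [map_add, add_apply, Prod.fst_add,
    fderiv_fderiv_fderiv_vertical_fst_eq_zero hU hQ hb, add_zero]

theorem exists_thirdDerivativeTerm_eq [Nontrivial (Fin m)] (hU : IsOpen U)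
    (hQ : Q ∈ maxLieInvarianceAlgebra (reducedSystem F β a c) U) (hb : b ∈ U) (i : Fin m) :
    ∃ r s : ℝ, ∀ g : Fin 2 → Fin m → ℝ, g 0 i * g 1 i = 0 →
      g 0 i * thirdDerivativeTerm Q b g i 1 - g 1 i * thirdDerivativeTerm Q b g i 0 =
        r * g 0 i ^ 2 + s * g 1 i ^ 2 := by
  let T := fderiv ℝ (fderiv ℝ (fderiv ℝ Q)) b
  let S (l μ : Fin 2) : ℝ := (T (tangent 0 0) (tangent 0 0) (tangent 0 μ)).1 l +
    (T (tangent 0 μ) (tangent 0 1) (tangent 0 1)).1 l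
  have hsnd (g : Fin 2 → Fin m → ℝ) (μ : Fin 2) (hμ : g μ i = 0) (x y : Base 2 m) :=
    fderiv_fderiv_fderiv_snd_eq_zero hU hQ hb (z := tangent g μ) hμ x y
  refine ⟨-S 0 1, S 1 0, fun g hgi => ?_⟩
  simp only [thirdDerivativeTerm, contactForm_apply, Prod.snd_add, Prod.fst_add, Pi.add_apply,
    fderiv_fderiv_fderiv_tangent_fst hU hQ hb g, Fin.sum_univ_two, Matrix.cons_val_one,
    Matrix.cons_val_fin_one, Matrix.cons_val_zero]
  rcases mul_eq_zero.1 hgi with h₀ | h₁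
  · simp only [h₀, hsnd g 0 h₀, S, T]
    ring
  · simp only [h₁, hsnd g 1 h₁, S, T]
    ring

theorem criterion_axis [Nontrivial (Fin m)] (hU : IsOpen U)
    (hQ : Q ∈ maxLieInvarianceAlgebra (reducedSystem F β a c) U) (hb : b ∈ U) {θ ρ : ℝ}
    {h : Fin m → ℝ} (hD : ∀ x, fderiv ℝ Q b x = conformalDiagonal θ ρ h x) (i : Fin m) :
    ∃ r s : ℝ, ∀ g : Fin 2 → Fin m → ℝ, (∀ k, g 0 k ^ 2 + g 1 k ^ 2 ≠ 0) → g 0 i * g 1 i = 0 →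
      -2 * (h i - 2 * θ) * (F.mulVec c i + a * β) -
        (h i - 2 * θ) * (g 0 i * F.mulVec (g 1) i - g 1 i * F.mulVec (g 0) i) +
        β * ((3 * θ - h i) * g 0 i + ρ * g 1 i) +
        (g 0 i * F.mulVec (h * g 1) i - g 1 i * F.mulVec (h * g 0) i) +
        (r * g 0 i ^ 2 + s * g 1 i ^ 2) = 0 := by
  obtain ⟨r, s, hrs⟩ := exists_thirdDerivativeTerm_eq hU hQ hb i
  exact ⟨r, s, fun g hg hgi => hrs g hgi ▸ criterion_conformalDiagonal hU hQ hb hD hg i⟩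

theorem rotation_eq_zero_and_diagonal_eq [Nontrivial (Fin m)] (hβ : β ≠ 0) (hU : IsOpen U)
    (hQ : Q ∈ maxLieInvarianceAlgebra (reducedSystem F β a c) U) (hb : b ∈ U) {θ ρ : ℝ}
    {h : Fin m → ℝ} (hD : ∀ x, fderiv ℝ Q b x = conformalDiagonal θ ρ h x) (i : Fin m) :
    ρ = 0 ∧ h i = 3 * θ := by
  obtain ⟨r, s, hrs⟩ := criterion_axis hU hQ hb hD i
  have hx (x : ℝ) (hx : x ≠ 0) := hrs ![fun _ => x, 0] (by simpa using hx) (by simp)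
  have hy (y : ℝ) (hy : y ≠ 0) := hrs ![0, fun _ => y] (by simpa using hy) (by simp)
  simp only [Matrix.cons_val_zero, Matrix.cons_val_one, Matrix.cons_val_fin_one, Matrix.mulVec_zero,
    Pi.zero_apply, mul_zero] at hx hy
  constructor
  · refine mul_left_cancel₀ hβ ?_
    linear_combination (hy 1 one_ne_zero - hy (-1) (by norm_num)) / 2
  · refine mul_left_cancel₀ hβ ?_
    linear_combination (hx (-1) (by norm_num) - hx 1 one_ne_zero) / 2

theorem diagonal_eq_of_coupling_ne_zero [Nontrivial (Fin m)] (hU : IsOpen U)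
    (hQ : Q ∈ maxLieInvarianceAlgebra (reducedSystem F β a c) U) (hb : b ∈ U) {θ ρ : ℝ}
    {h : Fin m → ℝ} (hD : ∀ x, fderiv ℝ Q b x = conformalDiagonal θ ρ h x) {i j : Fin m}
    (hij : i ≠ j) (hF : F i j ≠ 0) : h j = h i - 2 * θ := by
  obtain ⟨r, s, hrs⟩ := criterion_axis hU hQ hb hD i
  have hy (y : ℝ) (hy : y ≠ 0) := hrs ![1 - Pi.single j 1, Pi.single j y]
    (fun k => by by_cases hk : k = j <;> simp [hk, hy]) (by simp [hij])
  have hmul (y : ℝ) : h * Pi.single j y = Pi.single j (h j * y) := by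
    rw [Pi.single_mul_right]
  simp only [Matrix.cons_val_zero, Matrix.cons_val_one, Matrix.cons_val_fin_one, hmul,
    Matrix.mulVec_single, Pi.smul_apply, Pi.sub_apply, Pi.one_apply, Pi.single_eq_of_ne hij,
    Matrix.col_apply, MulOpposite.smul_eq_mul_unop, MulOpposite.unop_op] at hy
  refine mul_left_cancel₀ hF ?_
  linear_combination (hy 1 one_ne_zero - hy (-1) (by norm_num)) / 2

theorem fderiv_eq_zero_of_mem_maxLieInvarianceAlgebra (hF : ∃ i j, i ≠ j ∧ F i j ≠ 0) (hβ : β ≠ 0)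
    (hU : IsOpen U) (hQ : Q ∈ maxLieInvarianceAlgebra (reducedSystem F β a c) U) (hb : b ∈ U) :
    fderiv ℝ Q b = 0 := by
  obtain ⟨i, j, hij, hFij⟩ := hF
  have := nontrivial_of_ne i j hij
  obtain ⟨θ, ρ, h, hD⟩ := exists_fderiv_eq_conformalDiagonal hU hQ hb
  have hρ := rotation_eq_zero_and_diagonal_eq hβ hU hQ hb hD
  have hθ : θ = 0 := by
    linarith [diagonal_eq_of_coupling_ne_zero hU hQ hb hD hij hFij, hρ i, hρ j]
  have hh : h = 0 := funext fun k => by simp [hρ k, hθ]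
  refine ContinuousLinearMap.ext fun x => ?_
  ext k
  · fin_cases k <;> simp [hD, conformalDiagonal, hθ, hρ i]
  · simp [hD, conformalDiagonal, hh]

end ReducedSystem

/-! ### Iterated total derivatives -/

section IteratedTotalDerivatives

variable {n m : ℕ} {U : Set (Base n m)} {A : Jet n m → ℝ}

theorem totalDeriv_iterate_congr (hU : IsOpen U) (μ : Fin n) {A' : Jet n m → ℝ}
    (h : ∀ p, base p ∈ U → A p = A' p) (k : ℕ) :
    ∀ p, base p ∈ U → (totalDeriv μ)^[k] A p = (totalDeriv μ)^[k] A' p := by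
  induction k with
  | zero => exact h
  | succ k ih =>
    simp only [Function.iterate_succ_apply']
    exact fun p hp => totalDeriv_congr hU ih hp

namespace IsDifferentialPolynomial

theorem totalDeriv_iterate (hU : IsOpen U) (hA : IsDifferentialPolynomial U A) (μ : Fin n)
    (k : ℕ) : IsDifferentialPolynomial U ((QG.totalDeriv μ)^[k] A) := by
  induction k with
  | zero => exact hA
  | succ k ih =>
    rw [Function.iterate_succ_apply']
    exact ih.totalDeriv hU μ

theorem totalDeriv_iterate_comm (hU : IsOpen U) (hA : IsDifferentialPolynomial U A) (ν μ : Fin n)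
    (k : ℕ) : ∀ p, base p ∈ U →
      QG.totalDeriv ν ((QG.totalDeriv μ)^[k] A) p =
        (QG.totalDeriv μ)^[k] (QG.totalDeriv ν A) p := by
  induction k with
  | zero => exact fun _ _ => rfl
  | succ k ih =>
    intro p hp
    rw [Function.iterate_succ_apply', Function.iterate_succ_apply',
      (hA.totalDeriv_iterate hU μ k).totalDeriv_comm hU ν μ hp, totalDeriv_congr hU ih hp]

theorem foldr_totalDeriv (hU : IsOpen U) (hA : IsDifferentialPolynomial U A) (α : Fin n → ℕ)
    (l : List (Fin n)) : IsDifferentialPolynomial U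
      (l.foldr (fun μ B => (QG.totalDeriv μ)^[α μ] B) A) := by
  induction l with
  | nil => exact hA
  | cons μ l ih => exact ih.totalDeriv_iterate hU μ (α μ)

theorem totalDerivs (hU : IsOpen U) (hA : IsDifferentialPolynomial U A) (α : Fin n → ℕ) :
    IsDifferentialPolynomial U (totalDerivs α A) :=
  hA.foldr_totalDeriv hU α _

theorem totalDeriv_totalDerivs (hU : IsOpen U) (hA : IsDifferentialPolynomial U A)
    (α : Fin n → ℕ) (μ : Fin n) {p : Jet n m} (hp : base p ∈ U) :
    QG.totalDeriv μ (QG.totalDerivs α A) p = QG.totalDerivs (α + unitIndex μ) A p := by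
  let D (γ : Fin n → ℕ) (l : List (Fin n)) : Jet n m → ℝ :=
    l.foldr (fun ν B => (QG.totalDeriv ν)^[γ ν] B) A
  have hD_of_notMem (l : List (Fin n)) (hl : μ ∉ l) : D (α + unitIndex μ) l = D α l :=
    List.foldr_ext _ _ _ fun ν hν B => by
      have hνμ : ν ≠ μ := fun h => hl (h ▸ hν)
      simp [hνμ]
  have hD_of_mem (l : List (Fin n)) (hl : l.Nodup) (hμ : μ ∈ l) :
      ∀ p, base p ∈ U → QG.totalDeriv μ (D α l) p = D (α + unitIndex μ) l p := by
    induction l with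
    | nil => simp at hμ
    | cons ν l ih =>
      obtain ⟨hν, hl'⟩ := List.nodup_cons.1 hl
      intro p hp
      change QG.totalDeriv μ ((QG.totalDeriv ν)^[α ν] (D α l)) p =
        (QG.totalDeriv ν)^[(α + unitIndex μ) ν] (D (α + unitIndex μ) l) p
      by_cases hμν : μ = ν
      · subst hμν
        rw [hD_of_notMem l hν, show (α + unitIndex μ) μ = α μ + 1 by simp,
          Function.iterate_succ_apply']
      · rw [(hA.foldr_totalDeriv hU α l).totalDeriv_iterate_comm hU μ ν (α ν) p hp,
          show (α + unitIndex μ) ν = α ν by simp [Ne.symm hμν]]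
        exact totalDeriv_iterate_congr hU ν
          (ih hl' ((List.mem_cons.1 hμ).resolve_left hμν)) (α ν) p hp
  exact hD_of_mem _ (List.nodup_finRange n) (List.mem_finRange μ) p hp

end IsDifferentialPolynomial

theorem totalDerivs_zero (A : Jet n m → ℝ) : totalDerivs 0 A = A :=
  List.foldr_fixed _

theorem totalDerivs_induction {P : (Fin n → ℕ) → (Jet n m → ℝ) → Prop}
    (zero : P 0 A) (step : ∀ α μ B, P α B → P (α + unitIndex μ) (totalDeriv μ B))
    (α : Fin n → ℕ) : P α (totalDerivs α A) := by
  have iterate (μ : Fin n) {γ : Fin n → ℕ} {B : Jet n m → ℝ} (hB : P γ B) (k : ℕ) :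
      P (γ + Pi.single μ k) ((totalDeriv μ)^[k] B) := by
    induction k with
    | zero => simpa using hB
    | succ k ih =>
      rw [Function.iterate_succ_apply', Pi.single_add, ← add_assoc]
      exact step _ μ _ ih
  have fold (l : List (Fin n)) : P (l.map fun μ => Pi.single μ (α μ)).sum
      (l.foldr (fun μ B => (totalDeriv μ)^[α μ] B) A) := by
    induction l with
    | nil => exact zero
    | cons μ l ih =>
      rw [List.map_cons, List.sum_cons, add_comm]
      exact iterate μ ih (α μ)
  have h := fold (List.finRange n)
  rwa [← Fin.sum_univ_def, Finset.univ_sum_single] at h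

theorem add_unitIndex_ne_zero (α : Fin n → ℕ) (μ : Fin n) : α + unitIndex μ ≠ 0 := fun h => by
  simpa using congrFun h μ

theorem characteristic_eq (Q : VectorFieldOn n m) (j : Fin m) (p : Jet n m) : characteristic Q j p =
    (Q (base p)).2 j - horizontal j 0 p (Q (base p)) := by
  simp only [characteristic, horizontal, zero_add]

end IteratedTotalDerivatives

/-! ### Constant vector fields -/

section ConstantFields

variable {n m : ℕ} {U : Set (Base n m)} {Q : VectorFieldOn n m} {w : Base n m}

/-- The tangent vector of the jet space that translates `(x, u)` by `w` and fixes the derivatives of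
`u`; it is the prolongation of the constant vector field `w`. -/
def translationVec (w : Base n m) : Jet n m := (w.1, fun j α => if α = 0 then w.2 j else 0)

theorem prolongation_eq_translationVec (hU : IsOpen U) (hQ : ∀ b ∈ U, Q b = w) {p : Jet n m}
    (hp : base p ∈ U) : prolongation Q p = translationVec w := by
  have hχ (j : Fin m) (α : Fin n → ℕ) : ∀ p, base p ∈ U → totalDerivs α (characteristic Q j) p =
      (if α = 0 then w.2 j else 0) - horizontal j α p w := by
    refine totalDerivs_induction (P := fun α B => ∀ p, base p ∈ U → B p =
      (if α = 0 then w.2 j else 0) - horizontal j α p w) (fun p hp => ?_)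
      (fun α μ B hB p hp => ?_) α
    · simp [characteristic, horizontal, hQ _ hp]
    · have hH : HasTotalDeriv U μ (fun p => horizontal j α p w)
          (fun p => horizontal j (α + unitIndex μ) p w) := by
        simpa [horizontal] using HasTotalDeriv.horizontal
          (A := fun _ => w) (B := fun _ => 0) (fun _ _ => hasDerivAt_const _ _) j α
      rw [if_neg (add_unitIndex_ne_zero α μ), totalDeriv_congr hU hB hp]
      exact (HasTotalDeriv.sub (A := fun _ => if α = 0 then w.2 j else 0) (B := fun _ => 0)
        (fun _ _ => hasDerivAt_const _ _) hH).totalDeriv_eq hp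
  simp only [prolongation, translationVec, hχ _ _ p hp, hQ _ hp, horizontal, sub_add_cancel]

theorem mem_maxLieInvarianceAlgebra_of_translation_invariant {ι : Type} {E : ι → Jet n m → ℝ}
    (hE : ∀ i p w, E i (p + translationVec w) = E i p) (hU : IsOpen U) (hQ : ∀ b ∈ U, Q b = w) :
    Q ∈ maxLieInvarianceAlgebra E U := by
  refine ⟨contDiffOn_const.congr hQ, fun p hp _ i => ?_⟩
  have hsmul (s : ℝ) : s • translationVec w = translationVec (s • w) := by
    ext <;> simp [translationVec]
  simp only [prolongation_eq_translationVec hU hQ hp, lineDeriv, hsmul, hE, deriv_const]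

theorem totalDeriv_add_translationVec {A : Jet n m → ℝ} {r : ℝ}
    (hA : ∀ p, A (p + translationVec w) = A p + r) (μ : Fin n) (p : Jet n m) :
    totalDeriv μ A (p + translationVec w) = totalDeriv μ A p := by
  have hV : totalVec μ (p + translationVec w) = totalVec μ p := by
    simp [totalVec, translationVec]
  have hadd (s : ℝ) : p + translationVec w + s • totalVec μ p =
      p + s • totalVec μ p + translationVec w := add_right_comm _ _ _
  change lineDeriv ℝ A _ (totalVec μ _) = lineDeriv ℝ A p (totalVec μ p)
  simp only [hV, lineDeriv, hadd, hA, deriv_add_const]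

theorem poisson_add_translationVec {A B : Jet n m → ℝ} {r s : ℝ}
    (hA : ∀ p, A (p + translationVec w) = A p + r) (hB : ∀ p, B (p + translationVec w) = B p + s)
    (μ ν : Fin n) (p : Jet n m) :
    poisson μ ν A B (p + translationVec w) = poisson μ ν A B p := by
  simp only [poisson, totalDeriv_add_translationVec hA, totalDeriv_add_translationVec hB]

theorem mulVec_add_translationVec (F : Matrix (Fin m) (Fin m) ℝ) (p : Jet n m) (w : Base n m) :
    (F.mulVec fun j => (p + translationVec w).2 j 0) =
      (F.mulVec fun j => p.2 j 0) + F.mulVec w.2 := by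
  rw [← Matrix.mulVec_add]
  congr 1
  ext j
  simp [translationVec]

theorem vorticity_add_translationVec (F : Matrix (Fin m) (Fin m) ℝ) (β : ℝ) (i : Fin m)
    (w : Base 3 m) (p : Jet 3 m) : vorticity F β i (p + translationVec w) =
      vorticity F β i p + (F.mulVec w.2 i + β * w.1 2) := by
  have h₁ : (![0, 2, 0] : Fin 3 → ℕ) ≠ 0 := by decide
  have h₂ : (![0, 0, 2] : Fin 3 → ℕ) ≠ 0 := by decide
  simp only [vorticity, mulVec_add_translationVec]
  simp only [translationVec, Prod.snd_add, Prod.fst_add, Pi.add_apply, if_neg h₁, if_neg h₂]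
  ring

theorem reducedVorticity_add_translationVec (F : Matrix (Fin m) (Fin m) ℝ) (β : ℝ) (i : Fin m)
    (w : Base 2 m) (p : Jet 2 m) : reducedVorticity F β i (p + translationVec w) =
      reducedVorticity F β i p + (F.mulVec w.2 i + β * w.1 1) := by
  have h₁ : (![2, 0] : Fin 2 → ℕ) ≠ 0 := by decide
  have h₂ : (![0, 2] : Fin 2 → ℕ) ≠ 0 := by decide
  simp only [reducedVorticity, mulVec_add_translationVec]
  simp only [translationVec, Prod.snd_add, Prod.fst_add, Pi.add_apply, if_neg h₁, if_neg h₂]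
  ring

theorem const_mem_maxLieInvarianceAlgebra_model (F : Matrix (Fin m) (Fin m) ℝ) (β : ℝ)
    {U : Set (Base 3 m)} {Q : VectorFieldOn 3 m} {w : Base 3 m} (hU : IsOpen U)
    (hQ : ∀ b ∈ U, Q b = w) : Q ∈ maxLieInvarianceAlgebra (model F β) U := by
  refine mem_maxLieInvarianceAlgebra_of_translation_invariant (fun i p w => ?_) hU hQ
  have hq := vorticity_add_translationVec F β i w
  simp only [model, totalDeriv_add_translationVec hq,
    poisson_add_translationVec (A := fun p => p.2 i 0) (fun _ => rfl) hq]

theorem const_mem_maxLieInvarianceAlgebra_reducedSystem (F : Matrix (Fin m) (Fin m) ℝ) (β a : ℝ)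
    (c : Fin m → ℝ) {U : Set (Base 2 m)} {Q : VectorFieldOn 2 m} {w : Base 2 m} (hU : IsOpen U)
    (hQ : ∀ b ∈ U, Q b = w) : Q ∈ maxLieInvarianceAlgebra (reducedSystem F β a c) U := by
  refine mem_maxLieInvarianceAlgebra_of_translation_invariant (fun i p w => ?_) hU hQ
  simp only [reducedSystem, poisson_add_translationVec (A := fun p => p.2 i 0) (fun _ => rfl)
    (reducedVorticity_add_translationVec F β i w)]

theorem mem_span_partialX_partialU_iff {X : VectorFieldOn n m} :
    X ∈ Submodule.span ℝ (Set.range partialX ∪ Set.range partialU) ↔ ∃ w, X = fun _ => w := by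
  constructor
  · intro h
    induction h using Submodule.span_induction with
    | mem x hx =>
      rcases hx with ⟨μ, rfl⟩ | ⟨j, rfl⟩
      exacts [⟨_, rfl⟩, ⟨_, rfl⟩]
    | zero => exact ⟨0, rfl⟩
    | add x y _ _ hx hy =>
      obtain ⟨v, rfl⟩ := hx
      obtain ⟨w, rfl⟩ := hy
      exact ⟨v + w, rfl⟩
    | smul r x _ hx =>
      obtain ⟨v, rfl⟩ := hx
      exact ⟨r • v, rfl⟩
  · rintro ⟨w, rfl⟩
    have hw : (fun _ => w : VectorFieldOn n m) =
        ∑ μ, w.1 μ • partialX μ + ∑ j, w.2 j • partialU j := by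
      funext b
      ext k
      · simp [partialX, partialU, Prod.fst_sum, Finset.sum_apply, Pi.single_apply]
      · simp [partialX, partialU, Prod.snd_sum, Finset.sum_apply, Pi.single_apply]
    rw [hw]
    exact add_mem
      (sum_mem fun μ _ => Submodule.smul_mem _ _ (Submodule.subset_span (.inl ⟨μ, rfl⟩)))
      (sum_mem fun j _ => Submodule.smul_mem _ _ (Submodule.subset_span (.inr ⟨j, rfl⟩)))

end ConstantFields

/-! ### Lifting jets by the ansatz -/

section Lift

/-- The index of the variable `z_ν` whose total derivative corresponds to that of `t`, `x`, `y`
under the ansatz, up to the factor `reducedFactor`. -/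
def reducedVar : Fin 3 → Fin 2 := ![1, 0, 1]

/-- The factors in `∂_t = -a ∂_{z_2}`, `∂_x = ∂_{z_1}`, `∂_y = ∂_{z_2}` on functions of
`z_1 = x`, `z_2 = y - a t`. -/
def reducedFactor (a : ℝ) : Fin 3 → ℝ := ![-a, 1, 1]

/-- The multi-index of the derivative of `v` that the derivative of `ψ` with the multi-index `α` is
proportional to. -/
def reducedIndex (α : Fin 3 → ℕ) : Fin 2 → ℕ := ![α 1, α 0 + α 2]

theorem reducedIndex_add_unitIndex (α : Fin 3 → ℕ) (μ : Fin 3) :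
    reducedIndex (α + unitIndex μ) = reducedIndex α + unitIndex (reducedVar μ) := by
  refine funext (Fin.forall_fin_two.2 ⟨?_, ?_⟩)
  · fin_cases μ <;> rfl
  · fin_cases μ
    exacts [add_right_comm _ _ _, rfl, rfl]

theorem pow_add_unitIndex (a : ℝ) (α : Fin 3 → ℕ) (μ : Fin 3) :
    (-a) ^ (α + unitIndex μ) 0 = (-a) ^ α 0 * reducedFactor a μ := by
  fin_cases μ <;> simp [reducedFactor, pow_succ]

theorem eq_zero_of_add_unitIndex_eq {n : ℕ} {α : Fin n → ℕ} {μ ν : Fin n}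
    (h : α + unitIndex μ = unitIndex ν) : α = 0 := by
  have hsum := congrArg (fun γ : Fin n → ℕ => ∑ k, γ k) h
  simp only [Pi.add_apply, Finset.sum_add_distrib, Finset.sum_pi_single', Finset.mem_univ,
    if_true, add_eq_right] at hsum
  exact funext fun k => Finset.sum_eq_zero_iff.1 hsum k (Finset.mem_univ k)

variable {m : ℕ} (a : ℝ) (c : Fin m → ℝ)

/-- The derivative of `liftJet`: the tangent vector of the jet space of the model that corresponds
to the variation `V` of the jet of `v` and the variation `τ` of the time. -/
def liftVec (V : Jet 2 m) (τ : ℝ) : Jet 3 m :=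
  (![τ, V.1 0, V.1 1 + a * τ], fun j α =>
    (-a) ^ α 0 * V.2 j (reducedIndex α) + if α = 0 then c j * τ + a * V.1 0 else 0)

/-- The jet of `ψ^i = v^i(x, y - a t) + c_i t + a x` at the time `t`, given the jet `p` of `v`. -/
def liftJet (p : Jet 2 m) (t : ℝ) : Jet 3 m :=
  liftVec a c p t +
    (0, fun j α => (if α = unitIndex 0 then c j else 0) + if α = unitIndex 1 then a else 0)

theorem liftVec_add_smul (p V : Jet 2 m) (t τ s : ℝ) :
    liftVec a c (p + s • V) (t + s * τ) = liftVec a c p t + s • liftVec a c V τ := by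
  refine Prod.ext ?_ ?_
  · ext k
    fin_cases k
    · rfl
    · rfl
    · change p.1 1 + s * V.1 1 + a * (t + s * τ) = p.1 1 + a * t + s * (V.1 1 + a * τ)
      ring
  · ext j α
    simp only [liftVec, Prod.fst_add, Prod.snd_add, Prod.smul_fst, Prod.smul_snd, Pi.add_apply,
      Pi.smul_apply, smul_eq_mul]
    split_ifs <;> ring

theorem liftJet_add_smul (p V : Jet 2 m) (t τ s : ℝ) :
    liftJet a c (p + s • V) (t + s * τ) = liftJet a c p t + s • liftVec a c V τ := by
  rw [liftJet, liftVec_add_smul, liftJet, add_right_comm]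

theorem totalVec_liftJet (μ : Fin 3) (p : Jet 2 m) (t : ℝ) : totalVec μ (liftJet a c p t) =
    liftVec a c (reducedFactor a μ • totalVec (reducedVar μ) p)
      ((Pi.single μ 1 : Fin 3 → ℝ) 0) := by
  refine Prod.ext ?_ ?_
  · ext k
    fin_cases μ <;> fin_cases k <;> simp [totalVec, liftVec, reducedFactor, reducedVar]
  · ext j α
    change (-a) ^ (α + unitIndex μ) 0 * p.2 j (reducedIndex (α + unitIndex μ)) +
        (if α + unitIndex μ = 0 then _ else 0) +
        ((if α + unitIndex μ = unitIndex 0 then c j else 0) +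
          if α + unitIndex μ = unitIndex 1 then a else 0) =
      (-a) ^ α 0 * (reducedFactor a μ * p.2 j (reducedIndex α + unitIndex (reducedVar μ))) +
        if α = 0 then c j * (Pi.single μ 1 : Fin 3 → ℝ) 0 +
          a * (reducedFactor a μ * (Pi.single (reducedVar μ) 1 : Fin 2 → ℝ) 0) else 0
    rw [if_neg (add_unitIndex_ne_zero α μ), pow_add_unitIndex, reducedIndex_add_unitIndex,
      mul_assoc, add_zero]
    congr 1
    by_cases hα : α = 0
    · subst hα
      have hne : ∀ μ ν : Fin 3, (unitIndex μ = unitIndex ν) = (μ = ν) := by decide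
      fin_cases μ <;> simp [hne, reducedFactor, reducedVar]
    · have hne (ν : Fin 3) : α + unitIndex μ ≠ unitIndex ν :=
        fun h => hα (eq_zero_of_add_unitIndex_eq h)
      simp only [if_neg hα, if_neg (hne _), add_zero]

variable {a c}

theorem liftJet_zero (j : Fin m) (p : Jet 2 m) (t : ℝ) :
    (liftJet a c p t).2 j 0 = p.2 j 0 + a * p.1 0 + c j * t := by
  have h₀ : reducedIndex 0 = 0 := by decide
  have hne (μ : Fin 3) : (0 : Fin 3 → ℕ) ≠ unitIndex μ := by decide +revert
  simp only [liftJet, liftVec, Prod.snd_add, Pi.add_apply, h₀, if_neg (hne _), Pi.zero_apply,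
    if_true, pow_zero]
  ring

theorem invariants_base_liftJet (p : Jet 2 m) (t : ℝ) :
    invariants a c (base (liftJet a c p t)) = base p := by
  refine Prod.ext ?_ ?_
  · ext k
    fin_cases k <;> simp [liftJet, liftVec, invariants, base]
  · ext j
    have hx : (liftJet a c p t).1 1 = p.1 0 := add_zero _
    have ht : (liftJet a c p t).1 0 = t := add_zero _
    simp only [invariants, base, liftJet_zero, hx, ht]
    ring

variable {U : Set (Base 2 m)} {A : Jet 3 m → ℝ} {B : Jet 2 m → ℝ} {r : ℝ}

theorem lineDeriv_liftJet (hU : IsOpen U)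
    (h : ∀ p t, base p ∈ U → A (liftJet a c p t) = B p) {p : Jet 2 m} (hp : base p ∈ U)
    (t : ℝ) (V : Jet 2 m) (τ : ℝ) :
    lineDeriv ℝ A (liftJet a c p t) (liftVec a c V τ) = lineDeriv ℝ B p V := by
  refine Filter.EventuallyEq.deriv_eq
    ((eventually_base_add_smul_mem hU hp V).mono fun s hs => ?_)
  simp only [← liftJet_add_smul]
  exact h _ _ hs

theorem totalDeriv_liftJet (hU : IsOpen U) (hB : IsDifferentialPolynomial U B)
    (h : ∀ p t, base p ∈ U → A (liftJet a c p t) = B p + r * t) (μ : Fin 3) {p : Jet 2 m}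
    (hp : base p ∈ U) (t : ℝ) : totalDeriv μ A (liftJet a c p t) =
      reducedFactor a μ * totalDeriv (reducedVar μ) B p + r * (Pi.single μ 1 : Fin 3 → ℝ) 0 := by
  set V := reducedFactor a μ • totalVec (reducedVar μ) p
  set τ := (Pi.single μ 1 : Fin 3 → ℝ) 0
  have hBV : HasLineDerivAt ℝ B (reducedFactor a μ * totalDeriv (reducedVar μ) B p) p V :=
    (hB.hasTotalDeriv hU (reducedVar μ) p hp).smul _
  have hτ : HasDerivAt (fun s : ℝ => r * (t + s * τ)) (r * τ) 0 := by
    simpa using (((hasDerivAt_id (0 : ℝ)).mul_const τ).const_add t).const_mul r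
  change lineDeriv ℝ A _ (totalVec μ _) = _
  rw [totalVec_liftJet]
  refine HasLineDerivAt.lineDeriv (HasDerivAt.congr_of_eventuallyEq (HasDerivAt.add hBV hτ)
    ((eventually_base_add_smul_mem hU hp V).mono fun s hs => ?_))
  simp only [← liftJet_add_smul]
  exact h _ _ hs

theorem IsDifferentialPolynomial.reducedVorticity (F : Matrix (Fin m) (Fin m) ℝ) (β : ℝ)
    (i : Fin m) : IsDifferentialPolynomial U (reducedVorticity F β i) :=
  (((coord i _).add (coord i _)).add
    (sum Finset.univ fun j _ => (const (F i j)).mul (coord j 0))).add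
    ((const β).mul (ofBase (g := fun b => b.1 1) (by fun_prop)))

theorem vorticity_liftJet {F : Matrix (Fin m) (Fin m) ℝ} {i : Fin m} (hF : ∑ j, F i j = 0) (β : ℝ)
    (p : Jet 2 m) (t : ℝ) : vorticity F β i (liftJet a c p t) =
      reducedVorticity F β i p + (F.mulVec c i + a * β) * t := by
  have hxx : (liftJet a c p t).2 i ![0, 2, 0] = p.2 i ![2, 0] := by
    simp +decide [liftJet, liftVec, reducedIndex]
  have hyy : (liftJet a c p t).2 i ![0, 0, 2] = p.2 i ![0, 2] := by
    simp +decide [liftJet, liftVec, reducedIndex]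
  have hu : (fun j => (liftJet a c p t).2 j 0) =
      (fun j => p.2 j 0) + (t • c + (a * p.1 0) • 1) := by
    ext j
    simp only [liftJet_zero, Pi.add_apply, Pi.smul_apply, smul_eq_mul, Pi.one_apply]
    ring
  have hF₁ : F.mulVec 1 i = 0 := by simpa [Matrix.mulVec, dotProduct] using hF
  have hy : (liftJet a c p t).1 2 = p.1 1 + a * t := add_zero _
  simp only [vorticity, reducedVorticity, hxx, hyy, hu, hy, Matrix.mulVec_add, Matrix.mulVec_smul,
    Pi.add_apply, Pi.smul_apply, smul_eq_mul, hF₁]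
  ring

theorem model_liftJet {F : Matrix (Fin m) (Fin m) ℝ} {i : Fin m} (hF : ∑ j, F i j = 0) (β : ℝ)
    (p : Jet 2 m) (t : ℝ) : model F β i (liftJet a c p t) = reducedSystem F β a c i p := by
  have hq (μ : Fin 3) := totalDeriv_liftJet (a := a) (c := c) isOpen_univ
    (IsDifferentialPolynomial.reducedVorticity F β i) (fun p t _ => vorticity_liftJet hF β p t) μ
    (p := p) trivial t
  have hψ (μ : Fin 3) := totalDeriv_liftJet (a := a) (c := c) (A := fun p => p.2 i 0)
    isOpen_univ
    ((IsDifferentialPolynomial.coord i 0).add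
      ((IsDifferentialPolynomial.const a).mul (.ofBase (g := fun b => b.1 0) (by fun_prop))))
    (fun p t _ => (liftJet_zero i p t)) μ (p := p) trivial t
  have hv (μ : Fin 2) : totalDeriv μ (fun p => p.2 i 0 + a * (base p).1 0) p = _ :=
    ((hasTotalDeriv_coord (U := Set.univ) μ i 0).add
      ((hasTotalDeriv_x μ 0).const_mul a)).totalDeriv_eq (p := p) trivial
  simp only [model, poisson, reducedSystem, hq, hψ, hv, totalDeriv_coord]
  simp only [reducedFactor, reducedVar, Fin.isValue, Matrix.cons_val_zero, Matrix.cons_val_one,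
    Matrix.cons_val, Pi.single_eq_same, ne_eq, zero_ne_one, not_false_eq_true, Fin.reduceEq,
    Pi.single_eq_of_ne, mul_zero, add_zero, zero_add, mul_one, one_mul]
  ring

theorem totalDerivs_liftJet (hU : IsOpen U) (hB : IsDifferentialPolynomial U B)
    (h : ∀ p t, base p ∈ U → A (liftJet a c p t) = B p) (α : Fin 3 → ℕ) :
    ∀ p t, base p ∈ U → totalDerivs α A (liftJet a c p t) =
      (-a) ^ α 0 * totalDerivs (reducedIndex α) B p := by
  refine totalDerivs_induction (P := fun α A' => ∀ p t, base p ∈ U → A' (liftJet a c p t) =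
    (-a) ^ α 0 * totalDerivs (reducedIndex α) B p) ?_ (fun α μ A' ih p t hp => ?_) α
  · rw [show reducedIndex 0 = 0 by decide, totalDerivs_zero]
    simpa only [Pi.zero_apply, pow_zero, one_mul] using h
  · have hB' := hB.totalDerivs hU (reducedIndex α)
    have hD := totalDeriv_liftJet (r := 0) hU
      ((IsDifferentialPolynomial.const ((-a) ^ α 0)).mul hB') (by simpa using ih) μ hp t
    rw [hD, ((hB'.hasTotalDeriv hU _).const_mul _).totalDeriv_eq hp,
      hB.totalDeriv_totalDerivs hU _ _ hp, pow_add_unitIndex, reducedIndex_add_unitIndex]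
    ring

theorem horizontal_liftJet (j : Fin m) (α : Fin 3 → ℕ) (p : Jet 2 m) (t : ℝ) (P : Base 3 m) :
    horizontal j α (liftJet a c p t) P =
      (-a) ^ α 0 * horizontal j (reducedIndex α) p (invariants a c P) +
        if α = 0 then c j * P.1 0 + a * P.1 1 else 0 := by
  have h (μ : Fin 3) : (liftJet a c p t).2 j (α + unitIndex μ) = _ :=
    congrArg (fun V : Jet 3 m => V.2 j α) (totalVec_liftJet a c μ p t)
  simp only [horizontal, h, Fin.sum_univ_three, Fin.sum_univ_two]
  simp only [liftVec, totalVec, reducedFactor, reducedVar, invariants, Fin.isValue,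
    Matrix.cons_val_zero, Matrix.cons_val_one, Matrix.cons_val, Matrix.cons_val_fin_one,
    Prod.smul_mk, Pi.smul_apply, smul_eq_mul, Pi.single_eq_same, ne_eq, zero_ne_one, one_ne_zero,
    not_false_eq_true, Fin.reduceEq, Pi.single_eq_of_ne]
  split_ifs <;> ring

variable {Q : VectorFieldOn 3 m} {R : VectorFieldOn 2 m}

theorem characteristic_liftJet
    (hR : ∀ P, invariants a c P ∈ U → invariants a c (Q P) = R (invariants a c P)) (j : Fin m)
    (p : Jet 2 m) (t : ℝ) (hp : base p ∈ U) :
    characteristic Q j (liftJet a c p t) = characteristic R j p := by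
  have hQR := hR (base (liftJet a c p t)) (by rwa [invariants_base_liftJet])
  have hH := horizontal_liftJet (a := a) (c := c) j 0 p t (Q (base (liftJet a c p t)))
  rw [hQR, invariants_base_liftJet] at hH
  rw [invariants_base_liftJet] at hQR
  simp only [characteristic_eq, hH, ← hQR]
  simp only [invariants, Pi.zero_apply, pow_zero, one_mul, if_true,
    show reducedIndex 0 = 0 by decide]
  ring

theorem prolongation_liftJet (hU : IsOpen U) (hRs : ContDiffOn ℝ ∞ R U)
    (hR : ∀ P, invariants a c P ∈ U → invariants a c (Q P) = R (invariants a c P)) {p : Jet 2 m}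
    (hp : base p ∈ U) (t : ℝ) : prolongation Q (liftJet a c p t) =
      liftVec a c (prolongation R p) ((Q (base (liftJet a c p t))).1 0) := by
  have hQR := hR (base (liftJet a c p t)) (by rwa [invariants_base_liftJet])
  rw [invariants_base_liftJet] at hQR
  refine Prod.ext ?_ ?_
  · ext k
    fin_cases k <;> simp [prolongation, liftVec, ← hQR, invariants]
  · ext j α
    have hχ := totalDerivs_liftJet hU (.characteristic hRs j) (characteristic_liftJet hR j) α p t hp
    have hH := horizontal_liftJet (a := a) (c := c) j α p t (Q (base (liftJet a c p t)))
    simp only [horizontal] at hH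
    simp only [prolongation, hχ, hH, liftVec, ← hQR]
    simp only [invariants, Matrix.cons_val_zero]
    ring

theorem induced_mem_maxLieInvarianceAlgebra {F : Matrix (Fin m) (Fin m) ℝ}
    (hF : ∀ i, ∑ j, F i j = 0) (β : ℝ) (hU : IsOpen U) (hRs : ContDiffOn ℝ ∞ R U)
    (hQ : Q ∈ maxLieInvarianceAlgebra (model F β) (invariants a c ⁻¹' U))
    (hR : ∀ P, invariants a c P ∈ U → invariants a c (Q P) = R (invariants a c P)) :
    R ∈ maxLieInvarianceAlgebra (reducedSystem F β a c) U := by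
  refine ⟨hRs, fun p hp hE i => ?_⟩
  have hlift : base (liftJet a c p 0) ∈ invariants a c ⁻¹' U := by
    rwa [Set.mem_preimage, invariants_base_liftJet]
  have h := hQ.2 _ hlift (fun k => (model_liftJet (hF k) β p 0).trans (hE k)) i
  rwa [prolongation_liftJet hU hRs hR hp,
    lineDeriv_liftJet hU (fun p t _ => model_liftJet (hF i) β p t) hp] at h

end Lift

/-! ### Induced vector fields -/

section InducedFields

variable {m : ℕ} (a : ℝ) (c : Fin m → ℝ) {U : Set (Base 2 m)} {Q : VectorFieldOn 3 m}
  {R : VectorFieldOn 2 m}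

/-- The map `invariants a c` as a continuous linear map. -/
def invariantsCLM : Base 3 m →L[ℝ] Base 2 m :=
  LinearMap.toContinuousLinearMap
    { toFun := invariants a c
      map_add' := fun P P' => Prod.ext
        (funext (Fin.forall_fin_two.2 ⟨rfl, by
          change P.1 2 + P'.1 2 - a * (P.1 0 + P'.1 0) =
            P.1 2 - a * P.1 0 + (P'.1 2 - a * P'.1 0)
          ring⟩))
        (funext fun i => by
          simp only [invariants, Prod.fst_add, Prod.snd_add, Pi.add_apply]
          ring)
      map_smul' := fun r P => Prod.ext
        (funext (Fin.forall_fin_two.2 ⟨rfl, by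
          change r * P.1 2 - a * (r * P.1 0) = r * (P.1 2 - a * P.1 0)
          ring⟩))
        (funext fun i => by
          simp only [invariants, Prod.smul_fst, Prod.smul_snd, Pi.smul_apply, smul_eq_mul,
            RingHom.id_apply]
          ring) }

/-- The point over `(z, v)` with `t = 0`; this is a section of `invariants a c`. -/
def invariantsSection (b : Base 2 m) : Base 3 m :=
  (![0, b.1 0, b.1 1], fun i => b.2 i + a * b.1 0)

theorem invariants_invariantsSection (b : Base 2 m) :
    invariants a c (invariantsSection a b) = b := by
  refine Prod.ext ?_ ?_
  · ext k
    fin_cases k <;> simp [invariants, invariantsSection]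
  · ext k
    simp [invariants, invariantsSection]

theorem contDiff_invariantsSection : ContDiff ℝ ∞ (invariantsSection (m := m) a) := by
  refine ContDiff.prodMk (contDiff_pi.2 fun k => ?_) (by fun_prop)
  fin_cases k
  · exact contDiff_const
  · change ContDiff ℝ ∞ fun b : Base 2 m => b.1 0
    fun_prop
  · change ContDiff ℝ ∞ fun b : Base 2 m => b.1 1
    fun_prop

variable {a c}

theorem continuous_invariants : Continuous (invariants a c) := (invariantsCLM a c).continuous

theorem fderiv_invariants (P w : Base 3 m) :
    fderiv ℝ (invariants a c) P w = invariants a c w :=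
  congrArg (fun L => L w) (invariantsCLM a c).fderiv

theorem contDiffOn_of_induced (hQ : ContDiffOn ℝ ∞ Q (invariants a c ⁻¹' U))
    (hR : ∀ P, invariants a c P ∈ U → invariants a c (Q P) = R (invariants a c P)) :
    ContDiffOn ℝ ∞ R U := by
  have hmaps : Set.MapsTo (invariantsSection a) U (invariants a c ⁻¹' U) := fun b hb => by
    rwa [Set.mem_preimage, invariants_invariantsSection]
  refine ((invariantsCLM a c).contDiff.comp_contDiffOn
    (hQ.comp (contDiff_invariantsSection a).contDiffOn hmaps)).congr fun b hb => ?_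
  rw [← invariants_invariantsSection a c b, ← hR _ (hmaps hb), invariants_invariantsSection]
  rfl

theorem inducedAlgebra_subset {F : Matrix (Fin m) (Fin m) ℝ} (hF : ∀ i, ∑ j, F i j = 0) (β : ℝ)
    (hU : IsOpen U) :
    inducedAlgebra F β a c U ⊆ maxLieInvarianceAlgebra (reducedSystem F β a c) U := by
  rintro R ⟨Q, ⟨hQ, -⟩, hQR⟩
  have hR : ∀ P, invariants a c P ∈ U → invariants a c (Q P) = R (invariants a c P) :=
    fun P hP => by rw [← fderiv_invariants P, hQR P hP]
  exact induced_mem_maxLieInvarianceAlgebra hF β hU (contDiffOn_of_induced hQ.1 hR) hQ hR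

theorem const_mem_inducedAlgebra (F : Matrix (Fin m) (Fin m) ℝ) (β : ℝ) (hU : IsOpen U)
    {w : Base 2 m} (hR : ∀ b ∈ U, R b = w) : R ∈ inducedAlgebra F β a c U := by
  refine ⟨fun _ => invariantsSection a w, ⟨const_mem_maxLieInvarianceAlgebra_model F β
    (hU.preimage continuous_invariants) fun _ _ => rfl, fun S hS => ?_⟩, fun P hP => ?_⟩
  · obtain ⟨r, rfl⟩ := Submodule.mem_span_singleton.1 hS
    have hconst : r • generator a c = fun _ : Base 3 m => (r • generator a c) 0 := by
      funext P
      simp [generator, partialX, partialU]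
    refine ⟨0, zero_mem _, fun P _ => ?_⟩
    rw [hconst]
    simp [VectorField.lieBracket]
  · rw [fderiv_invariants, invariants_invariantsSection, hR _ hP]

end InducedFields

section CouplingMatrix

variable {m : ℕ} {f : Fin m → Fin m → ℝ}

theorem couplingMatrix_apply_of_adjacent {i j : Fin m} (h : Adjacent i j) :
    couplingMatrix f i j = f i j := by
  simp only [couplingMatrix, Matrix.of_apply, if_pos h]

theorem sum_couplingMatrix (f : Fin m → Fin m → ℝ) (i : Fin m) :
    ∑ j, couplingMatrix f i j = 0 := by
  have h (j : Fin m) : couplingMatrix f i j = (if Adjacent i j then f i j else 0) +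
      if i = j then -∑ k, (if Adjacent i k then f i k else 0) else 0 := by
    rcases eq_or_ne i j with rfl | hij
    · simp [couplingMatrix]
    · simp [couplingMatrix, hij]
  simp [h, Finset.sum_add_distrib]

end CouplingMatrix

theorem mem_maxLieInvarianceAlgebra_reducedSystem_iff {m : ℕ} {F : Matrix (Fin m) (Fin m) ℝ}
    (hF : ∃ i j, i ≠ j ∧ F i j ≠ 0) {β : ℝ} (hβ : β ≠ 0) (a : ℝ) (c : Fin m → ℝ)
    {U : Set (Base 2 m)} (hUo : IsOpen U) (hUc : IsPreconnected U) {Q : VectorFieldOn 2 m} :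
    Q ∈ maxLieInvarianceAlgebra (reducedSystem F β a c) U ↔ ∃ w, ∀ b ∈ U, Q b = w :=
  ⟨fun hQ => hUo.exists_is_const_of_fderiv_eq_zero hUc
    (hQ.1.differentiableOn (by simp))
    fun _ hb => fderiv_eq_zero_of_mem_maxLieInvarianceAlgebra hF hβ hUo hQ hb,
  fun ⟨_, hw⟩ => const_mem_maxLieInvarianceAlgebra_reducedSystem F β a c hUo hw⟩

end QG

end

theorem mainTheorem9_general {m : ℕ} {F : Matrix (Fin m) (Fin m) ℝ}
    (hF₀ : ∀ i, ∑ j, F i j = 0) (hF₁ : ∃ i j, i ≠ j ∧ F i j ≠ 0) {β : ℝ} (hβ : β ≠ 0) (a : ℝ)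
    (c : Fin m → ℝ) {U : Set (QG.Base 2 m)} (hUo : IsOpen U) (hUc : IsPreconnected U) :
    QG.maxLieInvarianceAlgebra (QG.reducedSystem F β a c) U =
        {Q | ∃ X ∈ Submodule.span ℝ
            (({QG.partialX 0, QG.partialX 1} : Set (QG.VectorFieldOn 2 m)) ∪
              Set.range QG.partialU), Set.EqOn Q X U} ∧
      QG.maxLieInvarianceAlgebra (QG.reducedSystem F β a c) U = QG.inducedAlgebra F β a c U := by
  have hconst {Q : QG.VectorFieldOn 2 m} :
      Q ∈ QG.maxLieInvarianceAlgebra (QG.reducedSystem F β a c) U ↔ ∃ w, ∀ b ∈ U, Q b = w :=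
    QG.mem_maxLieInvarianceAlgebra_reducedSystem_iff hF₁ hβ a c hUo hUc
  have hrange : {QG.partialX 0, QG.partialX 1} =
      Set.range (QG.partialX : Fin 2 → QG.VectorFieldOn 2 m) := by
    ext X
    simp [Fin.exists_fin_two, eq_comm]
  refine ⟨Set.ext fun Q => ?_, Set.Subset.antisymm (fun Q hQ => ?_)
    (QG.inducedAlgebra_subset hF₀ β hUo)⟩
  · simp only [hconst, hrange, Set.mem_ofPred_eq, QG.mem_span_partialX_partialU_iff]
    exact ⟨fun ⟨w, hw⟩ => ⟨_, ⟨w, rfl⟩, hw⟩, by rintro ⟨_, ⟨w, rfl⟩, hw⟩; exact ⟨w, hw⟩⟩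
  · obtain ⟨w, hw⟩ := hconst.1 hQ
    exact QG.const_mem_inducedAlgebra F β hUo hw

theorem mainTheorem9 {m : ℕ} (hm : 2 ≤ m)
    (f : Fin m → Fin m → ℝ) (hf : ∀ i j, QG.Adjacent i j → 0 < f i j)
    (β : ℝ) (hβ : 0 < β) (a : ℝ) (c : Fin m → ℝ)
    (hc : c ∈ Set.range (QG.couplingMatrix f).mulVec)
    (U : Set (QG.Base 2 m)) (hUo : IsOpen U) (hUc : IsConnected U) :
    QG.maxLieInvarianceAlgebra (QG.reducedSystem (QG.couplingMatrix f) β a c) U =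
        {Q | ∃ X ∈ Submodule.span ℝ
            (({QG.partialX 0, QG.partialX 1} : Set (QG.VectorFieldOn 2 m)) ∪
              Set.range QG.partialU), Set.EqOn Q X U} ∧
      QG.maxLieInvarianceAlgebra (QG.reducedSystem (QG.couplingMatrix f) β a c) U =
        QG.inducedAlgebra (QG.couplingMatrix f) β a c U := by
  exact mainTheorem9_general (QG.sum_couplingMatrix f)
    ⟨⟨0, by omega⟩, ⟨1, hm⟩, by simp,
      (QG.couplingMatrix_apply_of_adjacent (.inl rfl)).trans_ne (hf _ _ (.inl rfl)).ne'⟩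
    hβ.ne' a c hUo hUc.isPreconnected
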